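/- **Notation.** For $\sigma\in S_n$ (written $\sigma_1\cdots\sigma_n$, $\sigma_i=\sigma(i)$) let $\mathrm{exc}(\sigma)=|\{i:\sigma(i)>i\}|$, and let $\mathrm{Exd}(\sigma)\subseteq\{1,\dots,n-1\}$ be the descent set of the word obtained from $\sigma_1\cdots\sigma_n$ by barring $\sigma_i$ whenever $\sigma_i>i$, with respect to the order $\bar1<\dots<\bar n<1<\dots<n$. For $S\subseteq\{1,\dots,n-1\}$ let $F_{S,n}=\sum x_{i_1}\cdots x_{i_n}$, summed over all $i_1\ge\dots\ge i_n\ge1$ with $i_j>i_{j+1}$ for $j\in S$. Let $Q_{(n),j}=\sum F_{\mathrm{Exd}(\sigma),n}$, summed over the $n$-cycles $\sigma\in S_n$ with $\mathrm{exc}(\sigma)=j$. For a partition $\lambda=(\lambda_1,\dots,\lambda_k)$ of $n$ with $m_i$ parts equal to $i$ let $z_\lambda=\prod_i i^{m_i}m_i!$, $p_\lambda=\prod_i p_{\lambda_i}$ with $p_r=\sum_{i\ge1}x_i^r$, and $g(\lambda)=\gcd(\lambda_1,\dots,\lambda_k)$. The Frobenius characteristic of a virtual complex representation $V$ of $S_n$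 is $\mathrm{ch}\,V=\sum_{\lambda\vdash n}z_\lambda^{-1}\chi^V_\lambda p_\lambda$, where $\chi^V_\lambda$ is the value of the character of $V$ at elements of cycle type $\lambda$. Let $A_m(t)=\sum_{\sigma\in S_m}t^{\mathrm{exc}(\sigma)}$ (so $A_0=1$) and $[m]_t=1+t+\dots+t^{m-1}$. For a polynomial $F(t)=\sum_i a_it^i$ and $m\ge 1$ let $F(t)_m=\sum_{\gcd(m,i)=1}a_it^i$, and let $$G_\lambda(t)=\Bigl(tA_{k-1}(t)\prod_{i=1}^k[\lambda_i]_t\Bigr)_{g(\lambda)} .$$ **Statement.** Let $n\ge2$ and $j\ge0$. Then $Q_{(n),j}$ is the Frobenius characteristic of a virtual representation $V_{(n),j}$ of $S_n$. If $\lambda=(\lambda_1,\dots,\lambda_k)$ is a partition of $n$ with a part equal to $1$ (that is, $\lambda_k=1$ when the parts are listed in weakly decreasing order) and $\sigma\in S_n$ has cycle type $\lambda$, then the character of (any such) $V_{(n),j}$ at $\sigma$ equals the coefficient of $t^j$ in $tA_{k-1}(t)\prod_{i=1}^k[\lambda_i]_t$, and this is also the coefficient of $t^j$ in $G_\lambda(t)$.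 Consequently, in every expansion $Q_{(n),j}=\sum_{\mu\vdash n}c_\mu p_\mu$ with complex coefficients, $c_\lambda$ is $z_\lambda^{-1}$ times the coefficient of $t^j$ in $G_\lambda(t)$ for each $\lambda$ with a part equal to $1$. -/

import Mathlib

namespace EulerianQSym

open Finset Polynomial

noncomputable section

/-! ### Permutation statistics

The symmetric group on `[n]` is `Equiv.Perm (Fin n)`; positions and values are numbered from `0`. -/

/-- The excedance number: the number of `i` with `σ i > i`. -/
def exc {n : ℕ} (σ : Equiv.Perm (Fin n)) : ℕ :=
  (univ.filter fun i => i < σ i).card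

/-- The word over the ordered alphabet `1̄ < ⋯ < n̄ < 1 < ⋯ < n` obtained from the one-line notation
of `σ` by barring the letters in excedance positions. The barred letter with value `a` is
`(false, a)`, the unbarred one is `(true, a)`, and pairs are ordered lexicographically. -/
def barredWord {n : ℕ} (σ : Equiv.Perm (Fin n)) (i : Fin n) : Bool ×ₗ Fin n :=
  toLex (decide (σ i ≤ i), σ i)

/-- The descent set of a word `w` of length `n` over a linearly ordered alphabet: the (zero-based)
positions `i` with `i + 1 < n` and `w i > w (i + 1)`. -/
def wordDes {α : Type*} [LinearOrder α] {n : ℕ} (w : Fin n → α) : Set ℕ :=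
  {i | ∃ h : i + 1 < n, w ⟨i + 1, h⟩ < w ⟨i, Nat.lt_of_succ_lt h⟩}

/-- `Exd σ` is the descent set of the barred word of `σ`. -/
def exd {n : ℕ} (σ : Equiv.Perm (Fin n)) : Set ℕ :=
  wordDes (barredWord σ)

/-- The cycle type of a permutation, fixed points included, as a partition of `n`. -/
def cycleShape {n : ℕ} (σ : Equiv.Perm (Fin n)) : n.Partition where
  parts := σ.partition.parts
  parts_pos h := σ.partition.parts_pos h
  parts_sum := σ.partition.parts_sum.trans (Fintype.card_fin n)

/-! ### Power series in countably many variables `x_k`, `k : ℕ` -/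

/-- The sequences `s_0 ≥ s_1 ≥ ⋯ ≥ s_{n-1}` of indices with `s_i > s_{i+1}` for all `i ∈ S`, such
that `x_{s_0} ⋯ x_{s_{n-1}}` is the monomial with exponents `m`. -/
def fundamentalSeqs (n : ℕ) (S : Set ℕ) (m : ℕ →₀ ℕ) : Set (Fin n → ℕ) :=
  {s | Antitone s ∧
    (∀ (i : ℕ) (h : i + 1 < n), i ∈ S → s ⟨i + 1, h⟩ < s ⟨i, Nat.lt_of_succ_lt h⟩) ∧
    ∑ i, Finsupp.single (s i) 1 = m}

/-- Only finitely many sequences contribute to a given coefficient. -/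
theorem fundamentalSeqs_finite (n : ℕ) (S : Set ℕ) (m : ℕ →₀ ℕ) :
    (fundamentalSeqs n S m).Finite := by
  refine (Set.Finite.pi' (fun _ : Fin n => m.support.finite_toSet)).subset ?_
  rintro s ⟨-, -, rfl⟩ i
  simp only [Finset.mem_coe, Finsupp.mem_support_iff, Finsupp.finsetSum_apply, ne_eq,
    Finset.sum_eq_zero_iff, not_forall]
  exact ⟨i, mem_univ i, by simp⟩

/-- The fundamental quasisymmetric function `F_{S,n}`, the sum of `x_{s_0} ⋯ x_{s_{n-1}}` over
`s_0 ≥ ⋯ ≥ s_{n-1}` with `s_i > s_{i+1}` for `i ∈ S`. -/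
def fundamental (R : Type*) [CommRing R] (n : ℕ) (S : Set ℕ) : MvPowerSeries ℕ R :=
  fun m => ((fundamentalSeqs n S m).ncard : R)

open Classical in
/-- The cycle type Eulerian quasisymmetric function `Q_{λ,j}`. -/
def Q (R : Type*) [CommRing R] {n : ℕ} (lam : n.Partition) (j : ℕ) : MvPowerSeries ℕ R :=
  ∑ σ : Equiv.Perm (Fin n) with exc σ = j ∧ cycleShape σ = lam, fundamental R n (exd σ)

open Classical in
/-- The power sum `p_i = ∑_k x_k ^ i` (for `i ≥ 1`). -/
def powerSum (R : Type*) [CommRing R] (i : ℕ) : MvPowerSeries ℕ R :=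
  fun m => if ∃ k, m = Finsupp.single k i then 1 else 0

/-- `p_λ = ∏ p_{λ_i}`. -/
def powerSumPart (R : Type*) [CommRing R] {n : ℕ} (lam : n.Partition) : MvPowerSeries ℕ R :=
  (lam.parts.map (powerSum R)).prod

/-- `z_λ = ∏ i ^ {m_i} m_i!`, where `m_i` is the number of parts of `λ` equal to `i`. -/
def zee {n : ℕ} (lam : n.Partition) : ℕ :=
  ∏ i ∈ Icc 1 n, i ^ lam.parts.count i * (lam.parts.count i).factorial

/-! ### Virtual representations and the Frobenius characteristic -/

/-- A virtual complex representation of the symmetric group `S_n`: a formal difference of two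
finite-dimensional representations. -/
structure VirtualRep (n : ℕ) where
  pos : FDRep ℂ (Equiv.Perm (Fin n))
  neg : FDRep ℂ (Equiv.Perm (Fin n))

/-- The character of a virtual representation. -/
def VirtualRep.character {n : ℕ} (V : VirtualRep n) (σ : Equiv.Perm (Fin n)) : ℂ :=
  V.pos.character σ - V.neg.character σ

/-- Every partition of `n` is the cycle type of a permutation. -/
theorem exists_cycleShape {n : ℕ} (lam : n.Partition) :
    ∃ σ : Equiv.Perm (Fin n), cycleShape σ = lam := by
  have hle : (lam.parts.filter (2 ≤ ·)).sum ≤ n := by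
    calc (lam.parts.filter (2 ≤ ·)).sum
        ≤ (lam.parts.filter (2 ≤ ·)).sum + (lam.parts.filter fun a => ¬ 2 ≤ a).sum :=
          Nat.le_add_right _ _
      _ = n := by rw [← Multiset.sum_add, Multiset.filter_add_not, lam.parts_sum]
  obtain ⟨σ, hσ⟩ := (Equiv.Perm.exists_with_cycleType_iff (Fin n)
    (m := lam.parts.filter (2 ≤ ·))).2
      ⟨by simpa using hle, fun a ha => (Multiset.mem_filter.1 ha).2⟩
  refine ⟨σ, Nat.Partition.ext ?_⟩
  have hone : lam.parts.filter (fun a => ¬ 2 ≤ a)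
      = Multiset.replicate (lam.parts.filter fun a => ¬ 2 ≤ a).card 1 := by
    refine Multiset.eq_replicate_card.2 fun a ha => ?_
    have h1 := lam.parts_pos (Multiset.mem_filter.1 ha).1
    have h2 := (Multiset.mem_filter.1 ha).2
    omega
  have hcard : (lam.parts.filter fun a => ¬ 2 ≤ a).card
      = Fintype.card (Fin n) - σ.support.card := by
    have h1 : (lam.parts.filter (2 ≤ ·)).sum + (lam.parts.filter fun a => ¬ 2 ≤ a).sum = n := by
      rw [← Multiset.sum_add, Multiset.filter_add_not, lam.parts_sum]
    have h2 : (lam.parts.filter fun a => ¬ 2 ≤ a).sum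
        = (lam.parts.filter fun a => ¬ 2 ≤ a).card := by
      conv_lhs => rw [hone]
      simp
    have h3 := σ.sum_cycleType
    rw [hσ] at h3
    rw [Fintype.card_fin]
    omega
  change σ.cycleType + Multiset.replicate (Fintype.card (Fin n) - σ.support.card) 1 = lam.parts
  rw [hσ, ← hcard, ← hone, Multiset.filter_add_not]

/-- `χ^V_λ`, the value of the character of `V` on the conjugacy class of type `λ`. -/
def VirtualRep.characterAt {n : ℕ} (V : VirtualRep n) (lam : n.Partition) : ℂ :=
  V.character (exists_cycleShape lam).choose

/-- The value `χ^V_λ` does not depend on the chosen permutation of cycle type `λ`. -/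
theorem VirtualRep.characterAt_cycleShape {n : ℕ} (V : VirtualRep n) (σ : Equiv.Perm (Fin n)) :
    V.characterAt (cycleShape σ) = V.character σ := by
  have h := (exists_cycleShape (cycleShape σ)).choose_spec
  set τ := (exists_cycleShape (cycleShape σ)).choose with hτ
  have hc : IsConj σ τ := by
    rw [Equiv.Perm.partition_eq_of_isConj]
    exact Nat.Partition.ext (congrArg Nat.Partition.parts h).symm
  obtain ⟨g, hg⟩ := isConj_iff.1 hc
  change V.character τ = V.character σ
  rw [← hg]
  simp only [VirtualRep.character, FDRep.char_conj]

/-- The Frobenius characteristic `ch V = ∑_{λ ⊢ n} z_λ⁻¹ χ^V_λ p_λ`. -/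
def VirtualRep.frobenius {n : ℕ} (V : VirtualRep n) : MvPowerSeries ℕ ℂ :=
  ∑ lam : n.Partition, ((zee lam : ℂ)⁻¹ * V.characterAt lam) • powerSumPart ℂ lam

/-! ### Polynomials in `t` -/

/-- The Eulerian polynomial `A_n(t) = ∑_{σ ∈ S_n} t ^ exc σ`, with `A_0 = 1`. -/
def eulerianPoly (n : ℕ) : ℤ[X] :=
  ∑ σ : Equiv.Perm (Fin n), X ^ exc σ

/-- `[n]_t = 1 + t + ⋯ + t ^ (n - 1)`. -/
def tNat (n : ℕ) : ℤ[X] :=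
  ∑ i ∈ range n, X ^ i

/-- `t A_{k-1}(t) ∏ [λ_i]_t`, where `k` is the number of parts of `λ` (`k ≥ 1` when `n ≥ 1`). -/
def cyclePoly {n : ℕ} (lam : n.Partition) : ℤ[X] :=
  X * eulerianPoly (lam.parts.card - 1) * (lam.parts.map tNat).prod

/-- `F(t)_m`: erase from `F` all terms `a_i t ^ i` with `gcd (m, i) ≠ 1`. -/
def eraseNonCoprime (m : ℕ) (F : ℤ[X]) : ℤ[X] :=
  ∑ i ∈ F.support with Nat.gcd m i = 1, monomial i (F.coeff i)

/-- `G_λ(t) = (t A_{k-1}(t) ∏ [λ_i]_t)_{g(λ)}`, where `g(λ)` is the gcd of the parts of `λ`. -/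
def G {n : ℕ} (lam : n.Partition) : ℤ[X] :=
  eraseNonCoprime lam.parts.gcd (cyclePoly lam)

end

end EulerianQSym

namespace EulerianQSym

open Finset

section

open Polynomial

/-! ### Sums over partitions weighted by `z_λ⁻¹` -/

/-! To an $n$-cycle $\sigma$, a sequence $s$ compatible with $\mathrm{Exd}(\sigma)$ and a starting
point $i$, attach the periodic word of barred or unbarred letters read along the orbit of $i$. As in
the Gessel–Reutenauer correspondence, the $n$ rotations of this word, sorted lexicographically,
recover $\sigma$ and $s$. So in $N$ variables $n\sum_j Q_{(n),j}t^j$ is the weight sum of the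
primitive words of length $n$ that obey a local adjacency rule (`natCast_mul_sum_eq_primitiveSum`).
Without primitivity, such words are closed walks, counted by the trace of the $n$-th power of a
transfer matrix; sorted by minimal period $d$ they give the primitive sums at $x^{n/d},t^{n/d}$
(`sum_validWords`).

The transfer matrix is upper triangular plus rank one. Hence the generating function of its traces
is $\sum_a(1-x_az)^{-1}$ plus $-z\frac{d}{dz}\log(1-tS)$, where
$1+(1-t)S=\prod_a\frac{1-tx_az}{1-x_az}=e^{(1-t)u}$ and $u=\sum_l[l]_tp_lz^l/l$. Since
$\sum_kA_k(t)u^k/k!=(1+(1-t)S)/(1-tS)$, the second term is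
$z\frac{d}{dz}\sum_{k\ge1}tA_{k-1}(t)u^k/k!$. Expanding $u^k/k!$ over partitions with $k$ parts,
with weights $z_\lambda^{-1}$, yields `trace_transferMatrix_pow`: the trace is $p_n+n\sum_\lambda
z_\lambda^{-1}tA_{k-1}\prod[\lambda_i]_t\,p_\lambda$.

To pass to primitive words one subtracts the proper divisors $d$ of $n$. They involve only
partitions whose parts are all divisible by $n/d\ge2$, and $p_n$ has no part $1$ either. So the
coefficient of $p_\lambda$ is undisturbed when $\lambda$ has a part $1$ (`exists_primitiveSum_eq`);
then also $g(\lambda)=1$ and nothing is erased in $G_\lambda$.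

For virtuality, the power sum expansion shows that $Q_{(n),j}$ in $n$ variables is symmetric. It has
integer coefficients and degree $n$, so it is an integral combination of products of elementary
symmetric polynomials. Each product is the characteristic of a sign-twisted permutation
representation (`prod_esymm_eq_sum`). Independence of the $p_\lambda$ in $n$ variables identifies
the characters, and truncation transfers everything to power series. -/

theorem zee_eq_prod_Icc {n N : ℕ} (lam : n.Partition) (h : n ≤ N) :
    zee lam = ∏ i ∈ Icc 1 N, i ^ lam.parts.count i * (lam.parts.count i).factorial := by
  refine Finset.prod_subset (Icc_subset_Icc_right h) fun i hi hi' => ?_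
  have : i ∉ lam.parts := fun hm => hi' (by
    have := lam.le_of_mem_parts hm
    simp only [mem_Icc] at hi ⊢
    omega)
  simp [Multiset.count_eq_zero_of_notMem this]

theorem zee_pos {n : ℕ} (lam : n.Partition) : 0 < zee lam :=
  Finset.prod_pos fun i hi => by
    have : 0 < i := (mem_Icc.1 hi).1
    positivity

theorem zee_cons {n l : ℕ} (lam : n.Partition) (mu : (n - l).Partition) (h1 : 1 ≤ l) (hl : l ≤ n)
    (h : lam.parts = l ::ₘ mu.parts) :
    zee lam = l * lam.parts.count l * zee mu := by
  have hm : l ∈ Icc 1 n := mem_Icc.2 ⟨h1, hl⟩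
  rw [zee, zee_eq_prod_Icc mu (Nat.sub_le n l), ← mul_prod_erase _ _ hm, ← mul_prod_erase _ _ hm,
    h]
  have : ∀ i ∈ (Icc 1 n).erase l, i ^ (l ::ₘ mu.parts).count i *
      ((l ::ₘ mu.parts).count i).factorial = i ^ mu.parts.count i * (mu.parts.count i).factorial :=
    fun i hi => by rw [Multiset.count_cons_of_ne (ne_of_mem_erase hi)]
  rw [prod_congr rfl this, Multiset.count_cons_self, pow_succ, Nat.factorial_succ]
  ring

theorem sum_mul_count {n : ℕ} (lam : n.Partition) :
    ∑ l ∈ Icc 1 n, l * lam.parts.count l = n := by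
  conv_rhs => rw [← lam.parts_sum]
  rw [Finset.sum_multiset_count_of_subset lam.parts (Icc 1 n)]
  · exact sum_congr rfl fun i _ => by simp [mul_comm]
  · intro i hi
    rw [Multiset.mem_toFinset] at hi
    exact mem_Icc.2 ⟨lam.parts_pos hi, lam.le_of_mem_parts hi⟩

section PartSum

variable {R : Type*} [CommRing R] [Algebra ℚ R]

/-- `∑_{λ ⊢ n} z_λ⁻¹ f(ℓ(λ)) ∏ g(λ_i)`. -/
noncomputable def partSum (f g : ℕ → R) (n : ℕ) : R :=
  ∑ lam : n.Partition, ((zee lam : ℚ)⁻¹) • (f lam.parts.card * (lam.parts.map g).prod)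

theorem partSum_zero (f g : ℕ → R) : partSum f g 0 = f 0 := by
  simp [partSum, zee]

/-- Mark a part $l$ of $\lambda$ with weight $l\,m_l(\lambda)$. These weights add up to $n$, and
deleting one part $l$ divides $z_\lambda$ by exactly $l\,m_l(\lambda)$. The shift of `f` accounts
for the deleted part. -/
theorem natCast_mul_partSum (f g : ℕ → R) (n : ℕ) :
    (n : R) * partSum f g n =
      ∑ l ∈ Icc 1 n, g l * partSum (fun k => f (k + 1)) g (n - l) := by
  have key : ∀ l ∈ Icc 1 n, ∑ lam : n.Partition, ((l * lam.parts.count l : ℕ) : ℚ) •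
      ((zee lam : ℚ)⁻¹) • (f lam.parts.card * (lam.parts.map g).prod) =
      g l * partSum (fun k => f (k + 1)) g (n - l) := by
    intro l hl
    obtain ⟨h1, h2⟩ := mem_Icc.1 hl
    rw [← sum_subset (subset_univ (univ.filter fun lam : n.Partition => l ∈ lam.parts))]
    · rw [sum_subtype (p := fun lam : n.Partition => l ∈ lam.parts) _ (by simp),
        ← (Nat.Partition.partitionWithPartEquiv h1 h2).symm.sum_comp, partSum, mul_sum]
      refine sum_congr rfl fun mu _ => ?_
      have hp := Nat.Partition.partitionWithPartEquiv_symm_apply_parts h1 h2 mu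
      set lam := ((Nat.Partition.partitionWithPartEquiv h1 h2).symm mu).1
      have hc : (((l * lam.parts.count l : ℕ) : ℚ)) ≠ 0 := by
        have : 0 < lam.parts.count l := Multiset.count_pos.2 (by simp [hp])
        positivity
      rw [zee_cons lam mu h1 h2 hp, smul_smul, Nat.cast_mul (l * _), mul_inv, ← mul_assoc,
        mul_inv_cancel₀ hc, one_mul, hp, Multiset.card_cons, Multiset.map_cons,
        Multiset.prod_cons, mul_smul_comm]
      congr 1
      ring
    · intro lam _ h
      simp only [mem_filter, mem_univ, true_and] at h
      simp [Multiset.count_eq_zero_of_notMem h]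
  rw [← sum_congr rfl key, sum_comm, partSum, mul_sum]
  refine sum_congr rfl fun lam _ => ?_
  rw [← Finset.sum_smul, ← Nat.cast_sum, sum_mul_count, Nat.cast_smul_eq_nsmul, nsmul_eq_mul]

end PartSum

/-! ### The recurrence of the Eulerian polynomials -/

theorem exc_eq_sum {n : ℕ} (σ : Equiv.Perm (Fin n)) :
    exc σ = ∑ i, if i < σ i then 1 else 0 :=
  card_filter _ _

/-- A new smallest point is inserted into the arc $e^{-1}(q)\to q$. The arc into it is no excedance
and the arc out of it is one, so an excedance is gained unless the old arc already was one. -/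
theorem exc_decomposeFin_succ {n : ℕ} (e : Equiv.Perm (Fin n)) (q : Fin n) :
    exc (Equiv.Perm.decomposeFin.symm (q.succ, e)) =
      exc e + if e.symm q < q then 0 else 1 := by
  rw [exc_eq_sum, exc_eq_sum, Fin.sum_univ_succ, ← add_sum_erase univ _ (mem_univ (e.symm q)),
    ← add_sum_erase univ (fun i => if i < e i then 1 else 0) (mem_univ (e.symm q))]
  have : ∀ i ∈ univ.erase (e.symm q),
      (if i.succ < Equiv.Perm.decomposeFin.symm (q.succ, e) i.succ then 1 else 0) =
        if i < e i then 1 else 0 := by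
    intro i hi
    have hne : e i ≠ q := fun h => ne_of_mem_erase hi (by simp [← h])
    rw [Equiv.Perm.decomposeFin_symm_apply_succ, Equiv.swap_apply_of_ne_of_ne (Fin.succ_ne_zero _)
      (fun h => hne (Fin.succ_injective _ h))]
    simp
  rw [sum_congr rfl this]
  simp only [Equiv.Perm.decomposeFin_symm_apply_zero, Equiv.Perm.decomposeFin_symm_apply_succ,
    Equiv.apply_symm_apply, Equiv.swap_apply_right, Fin.succ_pos, if_true, Fin.not_lt_zero,
    if_false]
  split_ifs <;> omega

theorem exc_decomposeFin_zero {n : ℕ} (e : Equiv.Perm (Fin n)) :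
    exc (Equiv.Perm.decomposeFin.symm (0, e)) = exc e := by
  rw [exc_eq_sum, exc_eq_sum, Fin.sum_univ_succ]
  simp [Equiv.Perm.decomposeFin_symm_apply_succ]

theorem eulerianPoly_succ (n : ℕ) :
    eulerianPoly (n + 1) = (1 + (n : ℤ[X]) * X) * eulerianPoly n +
      X * (1 - X) * derivative (eulerianPoly n) := by
  have h : ∀ e : Equiv.Perm (Fin n), ∑ p : Fin (n + 1),
      (X : ℤ[X]) ^ exc (Equiv.Perm.decomposeFin.symm (p, e)) =
      X ^ exc e + ((exc e : ℤ[X]) * X ^ exc e + ((n : ℤ[X]) - (exc e : ℤ[X])) * (X * X ^ exc e)) := by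
    intro e
    rw [Fin.sum_univ_succ, exc_decomposeFin_zero, ← Equiv.sum_comp e]
    simp only [exc_decomposeFin_succ, Equiv.symm_apply_apply]
    congr 1
    have h1 : ∀ i, (X : ℤ[X]) ^ (exc e + if i < e i then 0 else 1) =
        X * X ^ exc e + (if i < e i then 1 else 0) * (X ^ exc e - X * X ^ exc e) := by
      intro i
      split_ifs <;> ring
    have h2 : (∑ i, if i < e i then (1 : ℤ[X]) else 0) = exc e := by
      rw [exc_eq_sum]
      push_cast
      rfl
    rw [sum_congr rfl fun i _ => h1 i, sum_add_distrib]
    simp only [← sum_mul, h2, sum_const, card_univ, Fintype.card_fin, nsmul_eq_mul]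
    ring
  rw [eulerianPoly, ← Equiv.Perm.decomposeFin.symm.sum_comp, Fintype.sum_prod_type_right]
  simp only [h]
  rw [eulerianPoly, derivative_sum, mul_sum, mul_sum, ← sum_add_distrib]
  refine sum_congr rfl fun e _ => ?_
  have : X * derivative ((X : ℤ[X]) ^ exc e) = (exc e : ℤ[X]) * X ^ exc e := by
    rcases exc e with _ | k
    · simp
    · simp only [derivative_X_pow_succ, map_add, map_natCast, map_one, Nat.cast_add, Nat.cast_one]
      ring
  linear_combination -(1 - X) * this

/-- The polynomials `r! S(k, r) (1 - t) ^ (k - r)`, with `S(k, r)` the Stirling numbers of the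
second kind. -/
noncomputable def surjPoly : ℕ → ℕ → ℤ[X]
  | 0, 0 => 1
  | 0, _ + 1 => 0
  | _ + 1, 0 => 0
  | k + 1, r + 1 => ((r : ℤ[X]) + 1) * ((1 - X) * surjPoly k (r + 1) + surjPoly k r)

theorem surjPoly_eq_zero_of_lt {k r : ℕ} (h : k < r) : surjPoly k r = 0 := by
  induction k generalizing r with
  | zero => obtain ⟨r, rfl⟩ := Nat.exists_eq_succ_of_ne_zero h.ne'; rfl
  | succ k ih =>
    obtain ⟨r, rfl⟩ := Nat.exists_eq_succ_of_ne_zero (Nat.ne_zero_of_lt h)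
    rw [surjPoly, ih (by omega), ih (by omega)]
    ring

theorem one_sub_X_mul_derivative_surjPoly (k r : ℕ) :
    (1 - X) * derivative (surjPoly k r) = ((r : ℤ[X]) - (k : ℤ[X])) * surjPoly k r := by
  induction k generalizing r with
  | zero => cases r <;> simp [surjPoly]
  | succ k ih =>
    cases r with
    | zero => simp [surjPoly]
    | succ r =>
      have h1 := ih (r + 1)
      have h2 := ih r
      simp only [surjPoly, derivative_mul, derivative_add, derivative_natCast, derivative_one,
        derivative_sub, derivative_X]
      push_cast at h1 h2 ⊢
      linear_combination ((r : ℤ[X]) + 1) * (1 - X) * h1 + ((r : ℤ[X]) + 1) * h2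

/-- Frobenius' formula $A_k(t)=\sum_r t^{r-1}r!\,S(k,r)(1-t)^{k-r}$ for $k\ge1$. The separate term
`surjPoly k 0` matters only for $k=0$. The Eulerian recurrence, applied termwise, reproduces the
Stirling recurrence. -/
theorem eulerianPoly_eq_sum_surjPoly (k : ℕ) :
    eulerianPoly k = surjPoly k 0 + ∑ r ∈ range k, X ^ r * surjPoly k (r + 1) := by
  induction k with
  | zero => simp [surjPoly, eulerianPoly, exc]
  | succ k ih =>
    have h0 := one_sub_X_mul_derivative_surjPoly k 0
    have hr : ∀ r ∈ range k, (1 + (k : ℤ[X]) * X) * (X ^ r * surjPoly k (r + 1)) +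
        X * (1 - X) * derivative (X ^ r * surjPoly k (r + 1)) =
        ((r : ℤ[X]) + 1) * (1 - X) * X ^ r * surjPoly k (r + 1) +
          ((r : ℤ[X]) + 2) * X ^ (r + 1) * surjPoly k (r + 1) := by
      intro r _
      have h1 := one_sub_X_mul_derivative_surjPoly k (r + 1)
      have h2 : X * derivative ((X : ℤ[X]) ^ r) = (r : ℤ[X]) * X ^ r := by
        rcases r with _ | r
        · simp
        · simp only [derivative_X_pow_succ, map_add, map_natCast, map_one, Nat.cast_add,
            Nat.cast_one]
          ring
      rw [derivative_mul]
      push_cast at h1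
      linear_combination (1 - X) * surjPoly k (r + 1) * h2 + X * X ^ r * h1
    have hs : ∀ r ∈ range (k + 1), X ^ r * surjPoly (k + 1) (r + 1) =
        ((r : ℤ[X]) + 1) * (1 - X) * X ^ r * surjPoly k (r + 1) +
          ((r : ℤ[X]) + 1) * X ^ r * surjPoly k r := by
      intro r _
      rw [surjPoly]
      ring
    rw [eulerianPoly_succ, ih, sum_congr rfl hs, sum_add_distrib, sum_range_succ,
      surjPoly_eq_zero_of_lt (Nat.lt_succ_self k), sum_range_succ' (fun r =>
        ((r : ℤ[X]) + 1) * X ^ r * surjPoly k r), derivative_add, derivative_sum,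
      mul_add, mul_add, mul_sum, mul_sum]
    have := sum_congr rfl hr
    rw [sum_add_distrib, sum_add_distrib] at this
    simp only [surjPoly]
    push_cast at h0 ⊢
    have h3 : ∑ r ∈ range k, ((r : ℤ[X]) + 1 + 1) * X ^ (r + 1) * surjPoly k (r + 1) =
      ∑ r ∈ range k, ((r : ℤ[X]) + 2) * X ^ (r + 1) * surjPoly k (r + 1) :=
      sum_congr rfl fun r _ => by ring
    linear_combination this + X * h0 - h3

/-! ### The operator $z\,d/dz$ and linear differential equations for power series. -/

section PowerSeriesPart

variable {R : Type*} [CommRing R]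

/-- The derivation `z d/dz` of formal power series. -/
noncomputable def eulerOp : Derivation R (PowerSeries R) (PowerSeries R) :=
  (PowerSeries.X : PowerSeries R) • PowerSeries.derivative R

theorem coeff_eulerOp (f : PowerSeries R) (n : ℕ) :
    PowerSeries.coeff n (eulerOp f) = n * PowerSeries.coeff n f := by
  rw [eulerOp, Derivation.smul_apply, smul_eq_mul]
  cases n with
  | zero => simp
  | succ n =>
    rw [PowerSeries.coeff_succ_X_mul, PowerSeries.coeff_derivative]
    push_cast
    ring

/-- As $\theta$ has no constant term, $zd'=\theta d$ expresses $n\,d_n$ through lower coefficients.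
This uniqueness principle stands in for exponentials and logarithms of series. -/
theorem eulerOp_injOn [NoZeroDivisors R] [CharZero R] {f g θ : PowerSeries R}
    (h0 : PowerSeries.constantCoeff f = PowerSeries.constantCoeff g)
    (hθ : PowerSeries.constantCoeff θ = 0)
    (h : eulerOp f - θ * f = eulerOp g - θ * g) : f = g := by
  rw [← sub_eq_zero]
  have hD : eulerOp (f - g) = θ * (f - g) := by
    rw [map_sub]
    linear_combination h
  have h0' : PowerSeries.coeff 0 (f - g) = 0 := by simp [h0]
  generalize f - g = d at hD h0'
  ext n
  induction n using Nat.strong_induction_on with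
  | _ n ih =>
    rcases Nat.eq_zero_or_pos n with rfl | hn
    · exact h0'
    have h1 := congrArg (PowerSeries.coeff n) hD
    rw [coeff_eulerOp, PowerSeries.coeff_mul, sum_eq_zero] at h1
    · exact (mul_eq_zero.1 h1).resolve_left (by exact_mod_cast hn.ne')
    · rintro ⟨i, j⟩ hij
      rw [HasAntidiagonal.mem_antidiagonal] at hij
      rcases Nat.eq_zero_or_pos i with rfl | hi
      · simp only [PowerSeries.coeff_zero_eq_constantCoeff, hθ, zero_mul]
      · simp [ih j (by simp only at hij; omega)]

theorem eulerOp_one_sub_C_mul_X (c : R) :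
    eulerOp (1 - PowerSeries.C c * PowerSeries.X) =
      (1 - PowerSeries.C c * PowerSeries.X) *
        PowerSeries.mk (fun l => if l = 0 then 0 else - c ^ l) := by
  ext n
  rw [coeff_eulerOp, sub_mul, one_mul, mul_assoc]
  rcases n with _ | _ | n
  · simp
  · simp [PowerSeries.coeff_succ_X_mul]
  · simp [PowerSeries.coeff_succ_X_mul, PowerSeries.coeff_one, pow_succ]
    ring

theorem eulerOp_prod_one_sub {ι : Type*} (s : Finset ι) (c : ι → R) :
    eulerOp (∏ a ∈ s, (1 - PowerSeries.C (c a) * PowerSeries.X)) =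
      (∏ a ∈ s, (1 - PowerSeries.C (c a) * PowerSeries.X)) *
        PowerSeries.mk (fun l => if l = 0 then 0 else - ∑ a ∈ s, c a ^ l) := by
  classical
  induction s using Finset.induction_on with
  | empty =>
    have : PowerSeries.mk (fun l => if l = 0 then 0 else - ∑ a ∈ (∅ : Finset ι), c a ^ l) =
        (0 : PowerSeries R) := by
      ext n
      simp
    rw [this]
    simp
  | insert a s ha ih =>
    have : PowerSeries.mk (fun l => if l = 0 then 0 else - ∑ a ∈ insert a s, c a ^ l) =
        PowerSeries.mk (fun l => if l = 0 then 0 else - c a ^ l) +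
          PowerSeries.mk (fun l => if l = 0 then 0 else - ∑ a ∈ s, c a ^ l) := by
      ext n
      rw [map_add, PowerSeries.coeff_mk, PowerSeries.coeff_mk, PowerSeries.coeff_mk]
      split_ifs
      · simp
      · rw [sum_insert ha, neg_add]
    rw [prod_insert ha, Derivation.leibniz, ih, this, eulerOp_one_sub_C_mul_X, smul_eq_mul,
      smul_eq_mul]
    ring

/-! ### The generating function of a function of the number of parts -/

section PhiSec

variable [Algebra ℚ R]

/-- The substitution of `∑ g_l z ^ l / l` into the exponential generating function of `f`. -/
noncomputable def partSeries (f g : ℕ → R) : PowerSeries R :=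
  PowerSeries.mk (partSum f g)

/-- The chain rule: with $u=\sum_{l\ge1}g_lz^l/l$, the series is $F(u)$ for $F$ the exponential
generating function of `f`, and shifting `f` differentiates $F$. The condition $g_0=0$ removes the
term $l=0$, which is absent from $zu'$. -/
theorem eulerOp_partSeries (f g : ℕ → R) (hg : g 0 = 0) :
    eulerOp (partSeries f g) = PowerSeries.mk g * partSeries (fun k => f (k + 1)) g := by
  ext n
  rw [coeff_eulerOp, partSeries, PowerSeries.coeff_mk, natCast_mul_partSum, PowerSeries.coeff_mul,
    Nat.sum_antidiagonal_eq_sum_range_succ_mk]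
  simp only [partSeries, PowerSeries.coeff_mk]
  rw [range_eq_Ico, sum_eq_sum_Ico_succ_bot (Nat.succ_pos n), hg, zero_mul, zero_add]
  rfl

theorem constantCoeff_partSeries (f g : ℕ → R) :
    PowerSeries.constantCoeff (partSeries f g) = f 0 := by
  rw [← PowerSeries.coeff_zero_eq_constantCoeff_apply, partSeries, PowerSeries.coeff_mk,
    partSum_zero]

theorem partSum_congr {f f' g : ℕ → R} {n : ℕ} (h : ∀ k ≤ n, f k = f' k) :
    partSum f g n = partSum f' g n :=
  sum_congr rfl fun lam _ => by
    rw [h]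
    calc lam.parts.card ≤ lam.parts.sum := by
          simpa using Multiset.card_nsmul_le_sum (a := 1) (fun i hi => lam.parts_pos hi)
      _ = n := lam.parts_sum

theorem partSeries_add (f f' g : ℕ → R) :
    partSeries (fun k => f k + f' k) g = partSeries f g + partSeries f' g := by
  ext n
  simp [partSeries, partSum, add_mul, sum_add_distrib]

theorem partSeries_mul_left (c : R) (f g : ℕ → R) :
    partSeries (fun k => c * f k) g = PowerSeries.C c * partSeries f g := by
  ext n
  simp [partSeries, partSum, mul_sum, mul_assoc]

theorem partSeries_zero (g : ℕ → R) : partSeries (fun _ => 0) g = 0 := by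
  ext n
  simp [partSeries, partSum]

variable [IsDomain R]

/-- A series `S` with `z S' = θ (1 + (1 - t) S)` has `r`-th power given by surjection polynomials. -/
theorem pow_eq_partSeries_surjPoly {g : ℕ → R} (hg : g 0 = 0) {t : R} {S : PowerSeries R}
    (hS0 : PowerSeries.constantCoeff S = 0)
    (hS : eulerOp S = PowerSeries.mk g * (1 + PowerSeries.C (1 - t) * S)) (r : ℕ) :
    S ^ r = partSeries (fun k => aeval t (surjPoly k r)) g := by
  have := algebraRat.charZero R
  have hg0 : PowerSeries.constantCoeff (PowerSeries.mk g) = 0 := by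
    rw [← PowerSeries.coeff_zero_eq_constantCoeff_apply, PowerSeries.coeff_mk, hg]
  induction r with
  | zero =>
    refine eulerOp_injOn (θ := 0) ?_ (map_zero _) ?_
    · rw [constantCoeff_partSeries]
      simp [surjPoly]
    · rw [eulerOp_partSeries _ _ hg]
      simp [surjPoly, partSeries_zero]
  | succ r ih =>
    -- With $\gamma=\sum g_lz^l$, both sides solve $zF'=(r+1)(1-t)\gamma F+(r+1)\gamma S^r$ with
    -- zero constant term.
    refine eulerOp_injOn (θ := PowerSeries.C ((r + 1) * (1 - t)) * PowerSeries.mk g) ?_ ?_ ?_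
    · rw [constantCoeff_partSeries]
      simp [surjPoly, hS0]
    · simp [hg0]
    · rw [eulerOp_partSeries _ _ hg]
      have : (fun k => aeval t (surjPoly (k + 1) (r + 1))) = fun k =>
          ((r + 1) * (1 - t)) * aeval t (surjPoly k (r + 1)) +
            (r + 1 : R) * aeval t (surjPoly k r) := by
        funext k
        simp only [surjPoly, map_mul, map_add, map_natCast, map_one, map_sub, aeval_X]
        ring
      rw [this, partSeries_add, partSeries_mul_left, partSeries_mul_left, ← ih,
        Derivation.leibniz_pow, hS]
      simp only [Nat.add_sub_cancel, smul_eq_mul, nsmul_eq_mul, map_mul, map_add, map_natCast,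
        map_one, map_sub]
      push_cast
      ring

/-- The hypotheses say $S=(e^{(1-t)u}-1)/(1-t)$, freed of denominators. Frobenius' formula turns
$\sum_kA_k(t)u^k/k!$ into the geometric series $1+\sum_rt^rS^{r+1}$, which is summed. -/
theorem partSeries_eulerianPoly_mul {g : ℕ → R} (hg : g 0 = 0) {t : R} {S : PowerSeries R}
    (hS0 : PowerSeries.constantCoeff S = 0)
    (hS : eulerOp S = PowerSeries.mk g * (1 + PowerSeries.C (1 - t) * S)) :
    partSeries (fun k => aeval t (eulerianPoly k)) g * (1 - PowerSeries.C t * S) =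
      1 + PowerSeries.C (1 - t) * S := by
  -- Coefficients up to $z^n$ involve partitions with at most $n$ parts, for which the terms $r\ge
  -- n$ of Frobenius' formula vanish; a finite geometric sum suffices.
  have hE : ∀ n, ∀ m ≤ n, PowerSeries.coeff m (partSeries (fun k => aeval t (eulerianPoly k)) g) =
      PowerSeries.coeff m (1 + ∑ r ∈ range n, PowerSeries.C (t ^ r) * S ^ (r + 1)) := by
    intro n m hm
    have h1 : (1 + ∑ r ∈ range n, PowerSeries.C (t ^ r) * S ^ (r + 1)) =
        partSeries (fun k => aeval t (surjPoly k 0 +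
          ∑ r ∈ range n, X ^ r * surjPoly k (r + 1))) g := by
      rw [← pow_zero S, pow_eq_partSeries_surjPoly hg hS0 hS 0]
      have : ∀ n, ∑ r ∈ range n, PowerSeries.C (t ^ r) * S ^ (r + 1) =
          partSeries (fun k => ∑ r ∈ range n, t ^ r * aeval t (surjPoly k (r + 1))) g := by
        intro n
        induction n with
        | zero => simp [partSeries_zero]
        | succ n ih =>
          simp only [sum_range_succ]
          rw [partSeries_add, partSeries_mul_left, ih, pow_eq_partSeries_surjPoly hg hS0 hS]
      rw [this, ← partSeries_add]
      simp
    rw [h1, partSeries, partSeries, PowerSeries.coeff_mk, PowerSeries.coeff_mk]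
    refine partSum_congr fun k hk => ?_
    rw [eulerianPoly_eq_sum_surjPoly]
    congr 2
    refine sum_subset (range_subset_range.2 (hk.trans hm)) fun r _ hr => ?_
    rw [surjPoly_eq_zero_of_lt (by simp only [mem_range] at hr; omega), mul_zero]
  have htel : ∀ n, (1 + ∑ r ∈ range n, PowerSeries.C (t ^ r) * S ^ (r + 1)) *
      (1 - PowerSeries.C t * S) =
      1 + PowerSeries.C (1 - t) * S - PowerSeries.C (t ^ n) * S ^ (n + 1) := by
    intro n
    induction n with
    | zero =>
      simp
      ring
    | succ n ih =>
      rw [sum_range_succ, ← add_assoc, add_mul, ih, pow_succ t, map_mul]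
      ring
  ext n
  have h2 : PowerSeries.coeff n
      (partSeries (fun k => aeval t (eulerianPoly k)) g * (1 - PowerSeries.C t * S)) =
      PowerSeries.coeff n ((1 + ∑ r ∈ range n, PowerSeries.C (t ^ r) * S ^ (r + 1)) *
        (1 - PowerSeries.C t * S)) := by
    rw [PowerSeries.coeff_mul, PowerSeries.coeff_mul]
    refine sum_congr rfl fun p hp => ?_
    rw [hE n p.1 ((Nat.le_add_right _ _).trans (HasAntidiagonal.mem_antidiagonal.1 hp).le)]
  rw [h2, htel, map_sub, sub_eq_self]
  have : (PowerSeries.X : PowerSeries R) ^ (n + 1) ∣ PowerSeries.C (t ^ n) * S ^ (n + 1) :=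
    Dvd.dvd.mul_left (pow_dvd_pow_of_dvd (PowerSeries.X_dvd_iff.2 hS0) _) _
  exact PowerSeries.X_pow_dvd_iff.1 this n (Nat.lt_succ_self n)

end PhiSec

end PowerSeriesPart

/-! ### Traces of powers of a triangular matrix plus a rank one matrix -/

section GeomMatrix

variable {R : Type*} [CommRing R] {ι : Type*} [Fintype ι] [DecidableEq ι]

/-- The matrix of power series `∑ A ^ n z ^ n = (1 - z A)⁻¹`. -/
noncomputable def geomMatrix (A : Matrix ι ι R) : Matrix ι ι (PowerSeries R) :=
  Matrix.of fun a b => PowerSeries.mk fun n => (A ^ n) a b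

/-- The matrix `z A`. -/
noncomputable def scaledMatrix (A : Matrix ι ι R) : Matrix ι ι (PowerSeries R) :=
  Matrix.of fun a b => PowerSeries.X * PowerSeries.C (A a b)

theorem geomMatrix_mul_one_sub (A : Matrix ι ι R) :
    geomMatrix A * (1 - scaledMatrix A) = 1 := by
  rw [mul_sub, mul_one, sub_eq_iff_eq_add]
  ext a b n
  rw [Matrix.add_apply, map_add, Matrix.mul_apply, map_sum]
  cases n with
  | zero =>
    simp [geomMatrix, scaledMatrix, Matrix.one_apply, apply_ite (PowerSeries.coeff 0)]
  | succ n =>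
    have : ∀ c, PowerSeries.coeff (n + 1) (geomMatrix A a c * scaledMatrix A c b) =
        (A ^ n) a c * A c b := by
      intro c
      simp [geomMatrix, scaledMatrix, ← mul_assoc, mul_comm _ (PowerSeries.X),
        PowerSeries.coeff_succ_X_mul]
    simp only [this, ← Matrix.mul_apply, ← pow_succ]
    rw [Matrix.one_apply]
    split_ifs <;> simp [geomMatrix, PowerSeries.coeff_one]

theorem one_sub_mul_geomMatrix (A : Matrix ι ι R) :
    (1 - scaledMatrix A) * geomMatrix A = 1 :=
  mul_eq_one_comm.1 (geomMatrix_mul_one_sub A)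

theorem coeff_geomMatrix_mul_self (A : Matrix ι ι R) (n : ℕ) (a b : ι) :
    PowerSeries.coeff n ((geomMatrix A * geomMatrix A) a b) = (n + 1) * (A ^ n) a b := by
  rw [Matrix.mul_apply, map_sum]
  simp only [geomMatrix, Matrix.of_apply, PowerSeries.coeff_mul, PowerSeries.coeff_mk]
  rw [sum_comm]
  simp only [← Matrix.mul_apply, ← pow_add]
  rw [sum_congr rfl fun p hp => by rw [HasAntidiagonal.mem_antidiagonal.1 hp]]
  simp

theorem trace_geomMatrix (A : Matrix ι ι R) :
    (geomMatrix A).trace = PowerSeries.mk fun n => (A ^ n).trace := by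
  ext n
  simp [Matrix.trace, geomMatrix]

/-- The series `z 1ᵀ (1 - z B)⁻¹ d`. -/
noncomputable def resolventSum (B : Matrix ι ι R) (d : ι → R) : PowerSeries R :=
  PowerSeries.X * ∑ a, (geomMatrix B).mulVec (fun b => PowerSeries.C (d b)) a

theorem eulerOp_resolventSum (B : Matrix ι ι R) (d : ι → R) :
    eulerOp (resolventSum B d) = PowerSeries.X *
      ∑ a, (geomMatrix B * geomMatrix B).mulVec (fun b => PowerSeries.C (d b)) a := by
  ext n
  rw [coeff_eulerOp, resolventSum]
  cases n with
  | zero => simp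
  | succ n =>
    rw [PowerSeries.coeff_succ_X_mul, PowerSeries.coeff_succ_X_mul, map_sum, map_sum, mul_sum]
    refine sum_congr rfl fun a _ => ?_
    simp only [Matrix.mulVec, dotProduct, map_sum, PowerSeries.coeff_mul_C,
      coeff_geomMatrix_mul_self, mul_sum]
    refine sum_congr rfl fun b _ => ?_
    simp only [geomMatrix, Matrix.of_apply, PowerSeries.coeff_mk]
    push_cast
    ring

theorem geomMatrix_sub (A B : Matrix ι ι R) :
    geomMatrix A - geomMatrix B =
      geomMatrix B * (scaledMatrix A - scaledMatrix B) * geomMatrix A := by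
  have h1 := geomMatrix_mul_one_sub B
  have h2 := one_sub_mul_geomMatrix A
  calc geomMatrix A - geomMatrix B
      = (geomMatrix B * (1 - scaledMatrix B)) * geomMatrix A -
          geomMatrix B * ((1 - scaledMatrix A) * geomMatrix A) := by rw [h1, h2, one_mul, mul_one]
    _ = _ := by noncomm_ring

/-- Sherman–Morrison, with $1+\alpha=(1-tS)^{-1}$ and $S=z\,1^{T}(1-zB)^{-1}d$. The trace changes by
$tzS'/(1-tS)$, the operator $z\,d/dz$ applied to $-\log(1-tS)$. -/
theorem trace_geomMatrix_add_rank_one (B : Matrix ι ι R) (d : ι → R) (t : R) :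
    ∃ α : PowerSeries R, (1 + α) * (1 - PowerSeries.C t * resolventSum B d) = 1 ∧
      (geomMatrix (B + Matrix.of fun a _ => t * d a)).trace =
        (geomMatrix B).trace + PowerSeries.C t * (1 + α) * eulerOp (resolventSum B d) := by
  set A := B + Matrix.of fun a _ => t * d a with hA
  set D : ι → PowerSeries R := fun b => PowerSeries.C (d b) with hD
  have hAB : scaledMatrix A - scaledMatrix B =
      (PowerSeries.X * PowerSeries.C t) • Matrix.vecMulVec D 1 := by
    ext1 a b
    simp [scaledMatrix, hA, hD, mul_add, mul_assoc]
  have hsub := geomMatrix_sub A B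
  rw [hAB] at hsub
  have hr : ∀ v : ι → PowerSeries R, ((PowerSeries.X * PowerSeries.C t) • Matrix.vecMulVec D 1).mulVec v =
      (PowerSeries.C t * (PowerSeries.X * ∑ a, v a)) • D := by
    intro v
    ext1 a
    simp only [Matrix.mulVec, dotProduct, Matrix.smul_apply, Matrix.vecMulVec_apply, Pi.one_apply,
      smul_eq_mul, mul_one, Pi.smul_apply, ← mul_sum]
    ring
  have hv : (geomMatrix A).mulVec D = (1 + PowerSeries.C t * resolventSum A d) •
      (geomMatrix B).mulVec D := by
    have h1 : (geomMatrix A).mulVec D - (geomMatrix B).mulVec D =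
        (PowerSeries.C t * resolventSum A d) • (geomMatrix B).mulVec D := by
      rw [← Matrix.sub_mulVec, hsub, ← Matrix.mulVec_mulVec, ← Matrix.mulVec_mulVec, hr,
        Matrix.mulVec_smul]
      rfl
    rw [add_smul, one_smul, ← h1]
    abel
  have hS : resolventSum A d = (1 + PowerSeries.C t * resolventSum A d) * resolventSum B d := by
    calc resolventSum A d = PowerSeries.X * ∑ a, (geomMatrix A).mulVec D a := rfl
      _ = PowerSeries.X * ∑ a, ((1 + PowerSeries.C t * resolventSum A d) •
          (geomMatrix B).mulVec D) a := by rw [hv]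
      _ = (1 + PowerSeries.C t * resolventSum A d) *
          (PowerSeries.X * ∑ a, (geomMatrix B).mulVec D a) := by
        simp only [Pi.smul_apply, smul_eq_mul, ← mul_sum]
        ring
  refine ⟨PowerSeries.C t * resolventSum A d, ?_, ?_⟩
  · linear_combination PowerSeries.C t * hS
  · have hsub' := geomMatrix_sub B A
    rw [← neg_sub (scaledMatrix A), hAB] at hsub'
    have htr : ∀ K : Matrix ι ι (PowerSeries R),
        (((PowerSeries.X * PowerSeries.C t) • Matrix.vecMulVec D 1) * K).trace =
          PowerSeries.C t * (PowerSeries.X * ∑ a, K.mulVec D a) := by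
      intro K
      simp only [Matrix.trace, Matrix.diag_apply, Matrix.mul_apply, Matrix.smul_apply,
        Matrix.vecMulVec_apply, Pi.one_apply, smul_eq_mul, mul_one, Matrix.mulVec, dotProduct,
        mul_sum]
      rw [sum_comm]
      refine sum_congr rfl fun a _ => sum_congr rfl fun b _ => ?_
      ring
    have h2 : (geomMatrix A).trace - (geomMatrix B).trace = PowerSeries.C t *
        (1 + PowerSeries.C t * resolventSum A d) * eulerOp (resolventSum B d) := by
      rw [← Matrix.trace_sub, ← neg_sub, hsub', Matrix.mul_neg, Matrix.neg_mul, neg_neg,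
        Matrix.trace_mul_cycle, Matrix.trace_mul_comm, htr, ← Matrix.mulVec_mulVec, hv,
        Matrix.mulVec_smul, Matrix.mulVec_mulVec, eulerOp_resolventSum]
      simp only [Pi.smul_apply, smul_eq_mul, ← mul_sum]
      ring
    rw [← h2]
    ring

end GeomMatrix

/-- Peel off the smallest index. Its equation reads $(1-x_0z)u_0=x_0(1+sz\sum_{b>0}u_b)$, so
including $u_0$ multiplies $1+sz\sum_{b>0}u_b$ by $(1-(1-s)x_0z)/(1-x_0z)$. -/
theorem resolvent_product {A : Type*} [CommRing A] {N : ℕ} (u x : Fin N → A) (s z : A)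
    (h : ∀ a, u a = x a + z * x a * (u a + s * ∑ b, if a < b then u b else 0)) :
    (1 + s * (z * ∑ a, u a)) * ∏ a, (1 - x a * z) = ∏ a, (1 - (1 - s) * x a * z) := by
  induction N with
  | zero => simp
  | succ N ih =>
    have h1 := ih (fun a => u a.succ) (fun a => x a.succ) (fun a => by
      simpa [Fin.sum_univ_succ] using h a.succ)
    have h2 := h 0
    simp only [Fin.sum_univ_succ, lt_irrefl, if_false, Fin.succ_pos, if_true, zero_add] at h2
    rw [Fin.prod_univ_succ, Fin.prod_univ_succ, ← h1, Fin.sum_univ_succ]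
    linear_combination (s * z * ∏ a : Fin N, (1 - x a.succ * z)) * h2

/-! ### The transfer matrix and the power sum expansion of its traces. -/

section TransferMatrix

variable {R : Type*} [CommRing R] {N : ℕ}

/-- The upper triangular part of the transfer matrix. -/
def upperMatrix (x : Fin N → R) (t : R) : Matrix (Fin N) (Fin N) R :=
  Matrix.of fun a b => x a * ((if a ≤ b then 1 else 0) - if a < b then t else 0)

/-- The transfer matrix of bicoloured words. -/
def transferMatrix (x : Fin N → R) (t : R) : Matrix (Fin N) (Fin N) R :=
  Matrix.of fun a b => x a * ((if b ≤ a then t else 0) + if a ≤ b then 1 else 0)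

theorem transferMatrix_eq (x : Fin N → R) (t : R) :
    transferMatrix x t = upperMatrix x t + Matrix.of fun a _ => t * x a := by
  ext a b
  simp only [transferMatrix, upperMatrix, Matrix.of_apply, Matrix.add_apply]
  rcases lt_trichotomy a b with h | rfl | h
  · simp [h, h.le, h.not_ge]; ring
  · simp; ring
  · simp [h.le, h.not_ge, h.not_gt]; ring

theorem upperMatrix_pow (x : Fin N → R) (t : R) (n : ℕ) :
    (∀ a b, b < a → (upperMatrix x t ^ n) a b = 0) ∧ ∀ a, (upperMatrix x t ^ n) a a = x a ^ n := by
  induction n with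
  | zero => exact ⟨fun a b h => by simp [h.ne'], fun a => by simp⟩
  | succ n ih =>
    have h0 : ∀ c b, b < c → upperMatrix x t c b = 0 := fun c b h => by
      simp [upperMatrix, h.not_ge, h.not_gt]
    refine ⟨fun a b h => ?_, fun a => ?_⟩
    · rw [pow_succ, Matrix.mul_apply, sum_eq_zero]
      intro c _
      rcases lt_or_ge c a with hc | hc
      · rw [ih.1 a c hc, zero_mul]
      · rw [h0 c b (h.trans_le hc), mul_zero]
    · rw [pow_succ, Matrix.mul_apply, sum_eq_single a]
      · rw [ih.2, pow_succ]
        simp [upperMatrix]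
      · intro c _ hc
        rcases lt_or_gt_of_ne hc with hc | hc
        · rw [ih.1 a c hc, zero_mul]
        · rw [h0 c a hc, mul_zero]
      · simp

theorem resolventSum_upperMatrix (x : Fin N → R) (t : R) :
    (1 + PowerSeries.C (1 - t) * resolventSum (upperMatrix x t) x) *
      ∏ a, (1 - PowerSeries.C (x a) * PowerSeries.X) =
      ∏ a, (1 - PowerSeries.C (t * x a) * PowerSeries.X) := by
  have := resolvent_product ((geomMatrix (upperMatrix x t)).mulVec fun b => PowerSeries.C (x b))
    (fun a => PowerSeries.C (x a)) (PowerSeries.C (1 - t)) PowerSeries.X (fun a => by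
      have h := congrArg (fun M => Matrix.mulVec M (fun b => PowerSeries.C (x b)))
        (one_sub_mul_geomMatrix (upperMatrix x t))
      simp only [← Matrix.mulVec_mulVec, Matrix.one_mulVec, Matrix.sub_mulVec] at h
      have h' := congrFun h a
      generalize (geomMatrix (upperMatrix x t)).mulVec (fun b => PowerSeries.C (x b)) = u at h'
      rw [Pi.sub_apply, sub_eq_iff_eq_add] at h'
      refine h'.trans ?_
      congr 1
      simp only [Matrix.mulVec, dotProduct, scaledMatrix, upperMatrix, Matrix.of_apply]
      rw [← add_sum_erase univ _ (mem_univ a), mul_add, mul_sum, mul_sum,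
        ← sum_erase univ (a := a) (by simp)]
      congr 1
      · simp
      · refine sum_congr rfl fun b hb => ?_
        rcases lt_or_gt_of_ne (ne_of_mem_erase hb) with h | h
        · simp [h.not_ge, h.not_gt]
        · simp [h, h.le, mul_assoc])
  rw [resolventSum, this]
  simp

variable [IsDomain R]

/-- Logarithmic derivative of `resolventSum_upperMatrix`: the difference of the two products
contributes $1-t^l=(1-t)[l]_t$. The factor $1-t$ is cancelled, whence `t ≠ 1`. -/
theorem eulerOp_resolventSum_upperMatrix (x : Fin N → R) {t : R} (ht : t ≠ 1) :
    eulerOp (resolventSum (upperMatrix x t) x) =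
      PowerSeries.mk (fun l => (aeval t (tNat l)) * ∑ a, x a ^ l) *
        (1 + PowerSeries.C (1 - t) * resolventSum (upperMatrix x t) x) := by
  set S := resolventSum (upperMatrix x t) x
  have hP := resolventSum_upperMatrix x t
  have hD := congrArg eulerOp hP
  rw [Derivation.leibniz, eulerOp_prod_one_sub, eulerOp_prod_one_sub, ← hP] at hD
  have hmk : PowerSeries.mk (fun l => if l = 0 then 0 else - ∑ a, (t * x a) ^ l) -
      PowerSeries.mk (fun l => if l = 0 then 0 else - ∑ a, x a ^ l) =
      PowerSeries.C (1 - t) * PowerSeries.mk (fun l => (aeval t (tNat l)) * ∑ a, x a ^ l) := by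
    ext l
    rw [map_sub, PowerSeries.coeff_C_mul]
    simp only [PowerSeries.coeff_mk]
    split_ifs with h
    · simp [h, tNat]
    · have := mul_neg_geom_sum t l
      simp only [tNat, map_sum, map_pow, aeval_X, mul_pow, ← mul_sum]
      linear_combination (- ∑ a, x a ^ l) * this
  have hne : ∏ a, (1 - PowerSeries.C (x a) * PowerSeries.X) ≠ 0 := by
    refine prod_ne_zero_iff.2 fun a _ h => ?_
    simpa using congrArg PowerSeries.constantCoeff h
  have hne' : PowerSeries.C (1 - t) ≠ 0 := by
    rw [Ne, map_eq_zero_iff _ PowerSeries.C_injective, sub_eq_zero]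
    exact ht.symm
  refine mul_left_cancel₀ hne' (mul_right_cancel₀ hne ?_)
  simp only [smul_eq_mul, map_add, Derivation.map_one_eq_zero, Derivation.leibniz] at hD
  have hC : eulerOp (PowerSeries.C (1 - t)) = 0 := by
    simp [eulerOp]
  rw [hC] at hD
  linear_combination hD + (1 + PowerSeries.C (1 - t) * S) *
    (∏ a, (1 - PowerSeries.C (x a) * PowerSeries.X)) * hmk

/-- The power sum expansion of the closed walk generating function. -/
theorem trace_transferMatrix_pow [Algebra ℚ R] (x : Fin N → R) {t : R} (ht : t ≠ 1) (n : ℕ) :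
    (transferMatrix x t ^ n).trace = ∑ a, x a ^ n + n * partSum
      (fun k => t * aeval t (eulerianPoly (k - 1)))
      (fun l => (aeval t (tNat l)) * ∑ a, x a ^ l) n := by
  set g : ℕ → R := fun l => (aeval t (tNat l)) * ∑ a, x a ^ l with hg
  have hg0 : g 0 = 0 := by simp [hg, tNat]
  obtain ⟨α, h1, h2⟩ := trace_geomMatrix_add_rank_one (upperMatrix x t) x t
  rw [← transferMatrix_eq, eulerOp_resolventSum_upperMatrix x ht] at h2
  have h3 := partSeries_eulerianPoly_mul (g := g) hg0 (t := t)
    (S := resolventSum (upperMatrix x t) x) (by simp [resolventSum])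
    (eulerOp_resolventSum_upperMatrix x ht)
  -- Recognises $tzS'/(1-tS)$ as a derivative: differentiating shifts $A_{k-1}$ to $A_k$. The
  -- truncated `k - 1` at $k=0$ affects only the constant term, which the operator kills.
  have h4 : PowerSeries.C t * (1 + α) * (PowerSeries.mk g *
      (1 + PowerSeries.C (1 - t) * resolventSum (upperMatrix x t) x)) =
      eulerOp (partSeries (fun k => t * aeval t (eulerianPoly (k - 1))) g) := by
    rw [eulerOp_partSeries _ _ hg0]
    simp only [Nat.add_sub_cancel]
    rw [partSeries_mul_left]
    linear_combination (-PowerSeries.C t * (1 + α) * PowerSeries.mk g) * h3 +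
      (PowerSeries.C t * PowerSeries.mk g *
        partSeries (fun k => aeval t (eulerianPoly k)) g) * h1
  rw [h4, trace_geomMatrix, trace_geomMatrix] at h2
  have h5 := congrArg (PowerSeries.coeff n) h2
  rw [map_add, coeff_eulerOp, partSeries, PowerSeries.coeff_mk, PowerSeries.coeff_mk,
    PowerSeries.coeff_mk] at h5
  rw [h5]
  congr 1
  exact sum_congr rfl fun a _ => (upperMatrix_pow x t n).2 a

end TransferMatrix

/-! ### Bicoloured periodic words -/

/-- Letters `(a, c)` with `c = false` for barred letters; larger values come first, and barred
letters precede unbarred ones. -/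
abbrev Letter (N : ℕ) := (Fin N)ᵒᵈ ×ₗ Bool

namespace Letter

variable {N : ℕ}

/-- The letter with value `a` and colour `c`. -/
def mk (a : Fin N) (c : Bool) : Letter N := toLex (OrderDual.toDual a, c)

/-- The absolute value of a letter. -/
def val (l : Letter N) : Fin N := OrderDual.ofDual (ofLex l).1

/-- The colour of a letter, `false` for barred letters. -/
def color (l : Letter N) : Bool := (ofLex l).2

@[simp] theorem val_mk (a : Fin N) (c : Bool) : (mk a c).val = a := rfl
@[simp] theorem color_mk (a : Fin N) (c : Bool) : (mk a c).color = c := rfl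

theorem ext_iff {l m : Letter N} : l = m ↔ l.val = m.val ∧ l.color = m.color := by
  change l = m ↔ (ofLex l).1 = (ofLex m).1 ∧ (ofLex l).2 = (ofLex m).2
  rw [← Prod.ext_iff]
  exact ofLex.injective.eq_iff.symm

theorem lt_iff {l m : Letter N} :
    l < m ↔ m.val < l.val ∨ l.val = m.val ∧ l.color < m.color := by
  rw [Prod.Lex.lt_iff]
  rfl

/-- Whether the second letter may follow the first one. -/
def Adj (l m : Letter N) : Prop :=
  (l.color = false → m.val ≤ l.val) ∧ (l.color = true → l.val ≤ m.val)

instance (l m : Letter N) : Decidable (Adj l m) := by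
  unfold Adj
  infer_instance

/-- The weight of a letter. -/
def weight {R : Type*} [CommRing R] (x : Fin N → R) (t : R) (l : Letter N) : R :=
  x l.val * if l.color then 1 else t

theorem weight_pow {R : Type*} [CommRing R] (x : Fin N → R) (t : R) (l : Letter N) (k : ℕ) :
    weight (fun a => x a ^ k) (t ^ k) l = weight x t l ^ k := by
  unfold weight
  split_ifs <;> simp [mul_pow]

/-- Letters as pairs. -/
def equivProd : Fin N × Bool ≃ Letter N where
  toFun p := mk p.1 p.2
  invFun l := (l.val, l.color)
  left_inv _ := rfl
  right_inv _ := rfl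

end Letter

/-! ### Periodic words and their minimal periods. -/

section Words

variable {N : ℕ}

/-- The shift of an infinite word. -/
def wordShift (w : ℕ → Letter N) : ℕ → Letter N := fun k => w (k + 1)

theorem wordShift_iterate (n : ℕ) (w : ℕ → Letter N) (k : ℕ) :
    wordShift^[n] w k = w (k + n) := by
  induction n generalizing w with
  | zero => rfl
  | succ n ih =>
    rw [Function.iterate_succ_apply, ih]
    exact congrArg w (by omega)

theorem isPeriodicPt_wordShift {n : ℕ} {w : ℕ → Letter N} :
    Function.IsPeriodicPt wordShift n w ↔ ∀ k, w (k + n) = w k := by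
  rw [Function.IsPeriodicPt, Function.IsFixedPt, funext_iff]
  simp only [wordShift_iterate]

theorem periodic_mod {n : ℕ} {w : ℕ → Letter N} (h : ∀ k, w (k + n) = w k) (k : ℕ) :
    w k = w (k % n) :=
  (Function.Periodic.map_mod_nat h k).symm

/-- Words all of whose consecutive letters are compatible. -/
def ValidWord (w : ℕ → Letter N) : Prop := ∀ k, (w k).Adj (w (k + 1))

theorem finite_validWords (N n : ℕ) :
    {w : ℕ → Letter N | 0 < n ∧ ValidWord w ∧ Function.IsPeriodicPt wordShift n w}.Finite := by
  refine Set.Finite.of_injOn (f := fun (w : ℕ → Letter N) (i : Fin n) => w i) (t := Set.univ)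
    (fun _ _ => Set.mem_univ _) ?_ Set.finite_univ
  rintro w ⟨hn, -, hw⟩ w' ⟨-, -, hw'⟩ h
  rw [isPeriodicPt_wordShift] at hw hw'
  funext k
  rw [periodic_mod hw, periodic_mod hw']
  exact congrFun h ⟨k % n, Nat.mod_lt _ hn⟩

/-- The valid words of period `n > 0`. -/
noncomputable def validWords (N n : ℕ) : Finset (ℕ → Letter N) :=
  (finite_validWords N n).toFinset

theorem mem_validWords {n : ℕ} {w : ℕ → Letter N} :
    w ∈ validWords N n ↔ 0 < n ∧ ValidWord w ∧ Function.IsPeriodicPt wordShift n w :=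
  Set.Finite.mem_toFinset _

open Classical in
/-- The valid words of minimal period `n > 0`. -/
noncomputable def primitiveWords (N n : ℕ) : Finset (ℕ → Letter N) :=
  (validWords N n).filter fun w => Function.minimalPeriod wordShift w = n

theorem mem_primitiveWords {n : ℕ} {w : ℕ → Letter N} :
    w ∈ primitiveWords N n ↔ 0 < n ∧ ValidWord w ∧ Function.minimalPeriod wordShift w = n := by
  rw [primitiveWords, mem_filter, mem_validWords]
  constructor
  · rintro ⟨⟨h1, h2, -⟩, h3⟩
    exact ⟨h1, h2, h3⟩
  · rintro ⟨h1, h2, h3⟩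
    exact ⟨⟨h1, h2, h3 ▸ Function.isPeriodicPt_minimalPeriod _ _⟩, h3⟩

variable {R : Type*} [CommRing R]

theorem prod_range_mul_of_periodic (f : Letter N → R) {w : ℕ → Letter N} {d : ℕ}
    (h : ∀ k, w (k + d) = w k) (q : ℕ) :
    ∏ i ∈ range (d * q), f (w i) = (∏ i ∈ range d, f (w i)) ^ q := by
  induction q with
  | zero => simp
  | succ q ih =>
    rw [Nat.mul_succ, prod_range_add, ih, pow_succ]
    congr 1
    refine prod_congr rfl fun i _ => ?_
    rw [periodic_mod h, Nat.mul_add_mod, ← periodic_mod h]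

/-- Sum of the weights of the primitive words of length `n`. -/
noncomputable def primitiveSum (n : ℕ) (x : Fin N → R) (t : R) : R :=
  ∑ w ∈ primitiveWords N n, ∏ i ∈ range n, (w i).weight x t

/-- A word of minimal period $d$ runs $n/d$ times through its period, so its weight is an $(n/d)$-th
power; raising $x$ and $t$ to that power has the same effect. -/
theorem sum_validWords {n : ℕ} (hn : 0 < n) (x : Fin N → R) (t : R) :
    ∑ w ∈ validWords N n, ∏ i ∈ range n, (w i).weight x t =
      ∑ d ∈ n.divisors, primitiveSum d (fun a => x a ^ (n / d)) (t ^ (n / d)) := by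
  classical
  rw [← sum_fiberwise_of_maps_to (s := validWords N n) (t := n.divisors)
    (g := fun w => Function.minimalPeriod wordShift w)]
  · refine sum_congr rfl fun d hd => ?_
    have hdn := Nat.dvd_of_mem_divisors hd
    have : (validWords N n).filter (fun w => Function.minimalPeriod wordShift w = d) =
        primitiveWords N d := by
      ext w
      rw [mem_filter, mem_validWords, mem_primitiveWords]
      constructor
      · rintro ⟨⟨-, h2, -⟩, h3⟩
        exact ⟨Nat.pos_of_mem_divisors hd, h2, h3⟩
      · rintro ⟨-, h2, h3⟩
        exact ⟨⟨hn, h2, Function.isPeriodicPt_iff_minimalPeriod_dvd.2 (h3 ▸ hdn)⟩, h3⟩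
    rw [this, primitiveSum]
    refine sum_congr rfl fun w hw => ?_
    have hp : ∀ k, w (k + d) = w k := isPeriodicPt_wordShift.1
      ((mem_primitiveWords.1 hw).2.2 ▸ Function.isPeriodicPt_minimalPeriod _ _)
    conv_lhs => rw [← Nat.mul_div_cancel' hdn]
    rw [prod_range_mul_of_periodic (fun l => l.weight x t) hp, ← prod_pow]
    exact prod_congr rfl fun i _ => (Letter.weight_pow _ _ _ _).symm
  · intro w hw
    rw [Nat.mem_divisors]
    exact ⟨Function.isPeriodicPt_iff_minimalPeriod_dvd.1 (mem_validWords.1 hw).2.2, hn.ne'⟩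

end Words

/-! ### Words as closed walks. -/

section ClosedWalks

variable {R : Type*} [CommRing R]

theorem matrix_pow_apply_eq_sum {ι : Type*} [Fintype ι] [DecidableEq ι] (A : Matrix ι ι R) (n : ℕ)
    (a b : ι) : (A ^ n) a b = ∑ v : Fin n → ι,
      if (Fin.cons a v : Fin (n + 1) → ι) (Fin.last n) = b then
        ∏ i, A ((Fin.cons a v : Fin (n + 1) → ι) i.castSucc) (v i) else 0 := by
  induction n generalizing a with
  | zero => simp [Matrix.one_apply]
  | succ n ih =>
    rw [pow_succ', Matrix.mul_apply, ← (Fin.consEquiv fun _ : Fin (n + 1) => ι).sum_comp,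
      Fintype.sum_prod_type]
    refine sum_congr rfl fun c _ => ?_
    rw [ih, mul_sum]
    refine sum_congr rfl fun v _ => ?_
    rw [mul_ite, mul_zero]
    simp only [Fin.consEquiv_apply, Fin.prod_univ_succ (n := n), Fin.castSucc_zero, Fin.cons_zero,
      Fin.cons_succ, ← Fin.succ_castSucc, ← Fin.succ_last]

variable {N : ℕ}

/-- The transfer matrix indexed by letters. -/
def letterMatrix (x : Fin N → R) (t : R) : Matrix (Letter N) (Letter N) R :=
  Matrix.of fun l m => if l.Adj m then l.weight x t else 0

theorem trace_letterMatrix_pow {n : ℕ} (hn : 0 < n) (x : Fin N → R) (t : R) :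
    (letterMatrix x t ^ n).trace = ∑ w ∈ validWords N n, ∏ i ∈ range n, (w i).weight x t := by
  obtain ⟨m, rfl⟩ : ∃ m, n = m + 1 := ⟨n - 1, by omega⟩
  let c : Letter N × (Fin (m + 1) → Letter N) → Fin (m + 1 + 1) → Letter N :=
    fun p => Fin.cons p.1 p.2
  let ext : Letter N × (Fin (m + 1) → Letter N) → ℕ → Letter N :=
    fun p k => c p ⟨k % (m + 1), (Nat.mod_lt _ hn).trans (Nat.lt_succ_self _)⟩
  have hext : ∀ p, c p (Fin.last _) = p.1 → ∀ (k : ℕ) (hk : k ≤ m + 1),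
      ext p k = c p ⟨k, Nat.lt_succ_of_le hk⟩ := by
    intro p hp k hk
    rcases hk.lt_or_eq with hk | rfl
    · simp only [ext, Nat.mod_eq_of_lt hk]
    · simp only [ext, Nat.mod_self]
      exact hp.symm
  have hper : ∀ p k, ext p (k + (m + 1)) = ext p k := by
    intro p k
    simp only [ext, Nat.add_mod_right]
  have hsum : (letterMatrix x t ^ (m + 1)).trace =
      ∑ p ∈ univ.filter (fun p : Letter N × (Fin (m + 1) → Letter N) =>
        c p (Fin.last _) = p.1 ∧ ∀ i : Fin (m + 1), (c p i.castSucc).Adj (c p i.succ)),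
        ∏ i : Fin (m + 1), (c p i.castSucc).weight x t := by
    rw [Matrix.trace, sum_filter, Fintype.sum_prod_type]
    refine sum_congr rfl fun l _ => ?_
    rw [Matrix.diag_apply, matrix_pow_apply_eq_sum]
    refine sum_congr rfl fun v _ => ?_
    simp only [letterMatrix, Matrix.of_apply, prod_ite_zero, mem_univ, true_imp_iff, c,
      Fin.cons_succ, ite_and]
  rw [hsum]
  refine sum_nbij' ext (fun w => (w 0, fun i => w (i + 1))) ?_ ?_ ?_ ?_ ?_
  · intro p hp
    obtain ⟨h1, h2⟩ := (mem_filter.1 hp).2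
    rw [mem_validWords, isPeriodicPt_wordShift]
    refine ⟨hn, fun k => ?_, hper p⟩
    have hlt := Nat.mod_lt k hn
    have e1 : ext p (k + 1) = ext p (k % (m + 1) + 1) := by
      rw [periodic_mod (hper p) (k + 1), periodic_mod (hper p) (k % (m + 1) + 1), Nat.mod_add_mod]
    rw [periodic_mod (hper p) k, e1, hext p h1 _ hlt.le, hext p h1 _ hlt]
    exact h2 ⟨k % (m + 1), hlt⟩
  · intro w hw
    obtain ⟨-, h1, h2⟩ := mem_validWords.1 hw
    rw [isPeriodicPt_wordShift] at h2
    have hc : ∀ i, c (w 0, fun i => w (i + 1)) i = w i := by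
      intro i
      refine Fin.cases rfl (fun i => ?_) i
      simp [c]
    rw [mem_filter]
    refine ⟨mem_univ _, ?_, fun i => ?_⟩
    · rw [hc, Fin.val_last]
      simpa using h2 0
    · rw [hc, hc]
      exact h1 i
  · intro p hp
    obtain ⟨h1, h2⟩ := (mem_filter.1 hp).2
    refine Prod.ext (hext p h1 0 (Nat.zero_le _)) (funext fun i => ?_)
    exact hext p h1 (i + 1) i.2
  · intro w hw
    obtain ⟨-, -, h2⟩ := mem_validWords.1 hw
    rw [isPeriodicPt_wordShift] at h2
    funext k
    have hc : ∀ i, c (w 0, fun i => w (i + 1)) i = w i := by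
      intro i
      refine Fin.cases rfl (fun i => ?_) i
      simp [c]
    exact (hc _).trans (periodic_mod h2 k).symm
  · intro p hp
    obtain ⟨h1, h2⟩ := (mem_filter.1 hp).2
    rw [prod_range]
    exact prod_congr rfl fun i _ => by rw [hext p h1 i i.2.le]; rfl

theorem trace_mul_pow_comm {ι κ : Type*} [Fintype ι] [DecidableEq ι] [Fintype κ] [DecidableEq κ]
    (A : Matrix ι κ R) (B : Matrix κ ι R) {n : ℕ} (hn : 0 < n) :
    ((A * B) ^ n).trace = ((B * A) ^ n).trace := by
  obtain ⟨m, rfl⟩ : ∃ m, n = m + 1 := ⟨n - 1, by omega⟩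
  have h : ∀ m, (A * B) ^ m * A = A * (B * A) ^ m := by
    intro m
    induction m with
    | zero => simp
    | succ m ih => rw [pow_succ, Matrix.mul_assoc, Matrix.mul_assoc A B A, ← Matrix.mul_assoc, ih,
        Matrix.mul_assoc, ← pow_succ]
  rw [pow_succ, ← Matrix.mul_assoc, h, Matrix.mul_assoc, Matrix.trace_mul_comm, Matrix.mul_assoc,
    ← pow_succ]

/-- Whether a letter may follow another depends only on its absolute value, so the matrix on letters
factors as $AB$ through absolute values. The opposite product $BA$ is the transfer matrix, and
traces of powers agree. -/
theorem sum_validWords_eq_trace {n : ℕ} (hn : 0 < n) (x : Fin N → R) (t : R) :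
    ∑ w ∈ validWords N n, ∏ i ∈ range n, (w i).weight x t = (transferMatrix x t ^ n).trace := by
  -- The colour `true` is arbitrary: `Letter.Adj` ignores the colour of its second argument.
  set A : Matrix (Letter N) (Fin N) R := Matrix.of fun l b =>
    if l.Adj (Letter.mk b true) then l.weight x t else 0 with hA
  set B : Matrix (Fin N) (Letter N) R := Matrix.of fun b m => if m.val = b then 1 else 0 with hB
  have h1 : letterMatrix x t = A * B := by
    ext l m
    have : ∀ b, A l b * B b m = if m.val = b then A l b else 0 := fun b => by simp [hB]
    rw [Matrix.mul_apply, sum_congr rfl fun b _ => this b, sum_ite_eq, if_pos (mem_univ _)]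
    rfl
  have h2 : transferMatrix x t = B * A := by
    ext a b
    rw [Matrix.mul_apply, ← Letter.equivProd.sum_comp, Fintype.sum_prod_type, sum_eq_single a]
    · have e1 : B a (Letter.mk a true) = 1 := if_pos rfl
      have e2 : B a (Letter.mk a false) = 1 := if_pos rfl
      have e3 : A (Letter.mk a true) b = if a ≤ b then x a else 0 := by
        simp [hA, Letter.Adj, Letter.weight]
      have e4 : A (Letter.mk a false) b = if b ≤ a then x a * t else 0 := by
        simp [hA, Letter.Adj, Letter.weight]
      rw [Fintype.sum_bool]
      change _ = B a (Letter.mk a true) * A (Letter.mk a true) b +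
        B a (Letter.mk a false) * A (Letter.mk a false) b
      rw [e1, e2, e3, e4, transferMatrix, Matrix.of_apply]
      split_ifs <;> ring
    · intro c _ hc
      refine sum_eq_zero fun d _ => ?_
      have : B a (Letter.equivProd (c, d)) = 0 := if_neg hc
      rw [this, zero_mul]
    · simp
  rw [← trace_letterMatrix_pow hn, h1, h2, trace_mul_pow_comm _ _ hn]

end ClosedWalks

/-! ### Words of the pairs counted by fundamental quasisymmetric functions -/

/-- Weakly decreasing sequences with strict descents at the positions in `S`. -/
def CompatSeq {n : ℕ} {α : Type*} [Preorder α] (S : Set ℕ) (s : Fin n → α) : Prop :=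
  Antitone s ∧ ∀ (i : ℕ) (h : i + 1 < n), i ∈ S → s ⟨i + 1, h⟩ < s ⟨i, Nat.lt_of_succ_lt h⟩

/-! ### The correspondence between cycles with compatible sequences and primitive words. -/

section OrbitWords

variable {n N : ℕ}

/-- The letter attached to the position `i`. -/
def letterAt (σ : Equiv.Perm (Fin n)) (s : Fin n → Fin N) (i : Fin n) : Letter N :=
  Letter.mk (s i) (decide (σ i ≤ i))

/-- The word read along the orbit of `i`. -/
def orbitWord (σ : Equiv.Perm (Fin n)) (s : Fin n → Fin N) (i : Fin n) : ℕ → Letter N :=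
  fun k => letterAt σ s ((σ ^ k) i)

theorem orbitWord_apply (σ : Equiv.Perm (Fin n)) (s : Fin n → Fin N) (i : Fin n) :
    orbitWord σ s (σ i) = wordShift (orbitWord σ s i) := by
  funext k
  simp only [orbitWord, wordShift, pow_succ, Equiv.Perm.mul_apply]

theorem orbitWord_pow_apply (σ : Equiv.Perm (Fin n)) (s : Fin n → Fin N) (i : Fin n) (k : ℕ) :
    orbitWord σ s ((σ ^ k) i) = wordShift^[k] (orbitWord σ s i) := by
  induction k with
  | zero => rfl
  | succ k ih => rw [pow_succ', Equiv.Perm.mul_apply, orbitWord_apply, ih,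
      Function.iterate_succ_apply']

theorem validWord_orbitWord {σ : Equiv.Perm (Fin n)} {s : Fin n → Fin N} (hs : Antitone s)
    (i : Fin n) : ValidWord (orbitWord σ s i) := by
  intro k
  simp only [orbitWord, pow_succ', Equiv.Perm.mul_apply]
  generalize (σ ^ k) i = j
  constructor
  · intro h
    simp only [letterAt, Letter.color_mk, decide_eq_false_iff_not, not_le] at h
    exact hs h.le
  · intro h
    simp only [letterAt, Letter.color_mk, decide_eq_true_eq] at h
    exact hs h

/-- If $s_i=s_j$, then $s$ is constant on $[i,j]$, so no position in between lies in
$\mathrm{Exd}(\sigma)$ and the barred word increases from $i$ to $j$. Its order compares colours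
first, then values of $\sigma$. -/
theorem letterAt_lt_or {σ : Equiv.Perm (Fin n)} {s : Fin n → Fin N} (hs : CompatSeq (exd σ) s)
    {i j : Fin n} (hij : i < j) :
    letterAt σ s i < letterAt σ s j ∨ letterAt σ s i = letterAt σ s j ∧ σ i < σ j := by
  rcases (hs.1 hij.le).lt_or_eq with h | h
  · exact Or.inl (Letter.lt_iff.2 (Or.inl h))
  have hmono : ∀ d (hd : i.1 + d < n), i.1 + d ≤ j →
      barredWord σ i ≤ barredWord σ ⟨i.1 + d, hd⟩ := by
    intro d
    induction d with
    | zero => exact fun _ _ => le_rfl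
    | succ d ih =>
      intro hd hj
      refine (ih (by omega) (by omega)).trans (not_lt.1 fun hlt => ?_)
      have h1 := hs.2 (i.1 + d) hd ⟨hd, hlt⟩
      have h2 : s ⟨i.1 + d, by omega⟩ ≤ s i := hs.1 (Fin.le_def.2 (by simp))
      have h3 : s j ≤ s ⟨i.1 + d + 1, hd⟩ := hs.1 (Fin.le_def.2 hj)
      exact absurd (h3.trans_lt (h1.trans_le h2)) (by simp [h])
  have hle : barredWord σ i ≤ barredWord σ j := by
    have := hmono (j - i) (by omega) (by omega)
    have e : (⟨i.1 + (j.1 - i.1), by omega⟩ : Fin n) = j := Fin.ext (by simp only; omega)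
    rwa [e] at this
  have hne : barredWord σ i ≠ barredWord σ j := fun he =>
    hij.ne (σ.injective (congrArg (fun p => (ofLex p).2) he))
  have hlt := hle.lt_of_ne hne
  rw [Prod.Lex.lt_iff] at hlt
  rcases hlt with h1 | ⟨h1, h2⟩
  · exact Or.inl (Letter.lt_iff.2 (Or.inr ⟨h.symm, h1⟩))
  · exact Or.inr ⟨Letter.ext_iff.2 ⟨h.symm, h1⟩, h2⟩

/-- As long as the letters agree, the order of the two positions is preserved by $\sigma$. If they
agreed forever, writing $j=\sigma^d(i)$ would give an infinite chain
$i<\sigma^d(i)<\sigma^{2d}(i)<\cdots$ in a finite set. -/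
theorem strictMono_orbitWord {σ : Equiv.Perm (Fin n)} (hσ : σ.IsCycleOn Set.univ)
    {s : Fin n → Fin N} (hs : CompatSeq (exd σ) s) :
    StrictMono fun i => toLex (orbitWord σ s i) := by
  intro i j hij
  have key : ∀ k, (∃ m, (∀ l < m, orbitWord σ s i l = orbitWord σ s j l) ∧
      orbitWord σ s i m < orbitWord σ s j m) ∨
      ((∀ l < k, orbitWord σ s i l = orbitWord σ s j l) ∧ (σ ^ k) i < (σ ^ k) j) := by
    intro k
    induction k with
    | zero => exact Or.inr ⟨fun l hl => absurd hl (Nat.not_lt_zero l), hij⟩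
    | succ k ih =>
      rcases ih with h | ⟨h1, h2⟩
      · exact Or.inl h
      rcases letterAt_lt_or hs h2 with h | ⟨h, h'⟩
      · exact Or.inl ⟨k, h1, h⟩
      · refine Or.inr ⟨fun l hl => ?_, by simpa [pow_succ'] using h'⟩
        rcases Nat.lt_succ_iff_lt_or_eq.1 hl with hl | rfl
        · exact h1 l hl
        · exact h
  by_cases hex : ∃ m, (∀ l < m, orbitWord σ s i l = orbitWord σ s j l) ∧
      orbitWord σ s i m < orbitWord σ s j m
  · exact hex
  have hlt : ∀ k, (σ ^ k) i < (σ ^ k) j := fun k => ((key k).resolve_left hex).2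
  obtain ⟨d, rfl⟩ := hσ.exists_pow_eq' Set.finite_univ (Set.mem_univ i) (Set.mem_univ j)
  have hinc : StrictMono fun m : ℕ => (σ ^ (d * m)) i := strictMono_nat_of_lt_succ fun m => by
    have := hlt (d * m)
    rwa [← Equiv.Perm.mul_apply, ← pow_add] at this
  exact absurd hinc.injective (not_injective_infinite_finite _)

theorem minimalPeriod_orbitWord {σ : Equiv.Perm (Fin n)} (hσ : σ.IsCycleOn Set.univ)
    {s : Fin n → Fin N} (hs : CompatSeq (exd σ) s) (i : Fin n) :
    Function.minimalPeriod wordShift (orbitWord σ s i) = n := by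
  have hσ' : σ.IsCycleOn ((univ : Finset (Fin n)) : Set (Fin n)) := by simpa using hσ
  have hiff : ∀ d, Function.IsPeriodicPt wordShift d (orbitWord σ s i) ↔ n ∣ d := by
    intro d
    rw [Function.IsPeriodicPt, Function.IsFixedPt, ← orbitWord_pow_apply]
    have hc := hσ'.pow_apply_eq (mem_univ i) (n := d)
    rw [card_univ, Fintype.card_fin] at hc
    rw [← hc]
    exact (strictMono_orbitWord hσ hs).injective.eq_iff
  refine Nat.dvd_antisymm ?_ ?_
  · exact Function.isPeriodicPt_iff_minimalPeriod_dvd.1 ((hiff n).2 dvd_rfl)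
  · exact (hiff _).1 (Function.isPeriodicPt_minimalPeriod _ _)

/-- The words at all positions are the rotations of any one of them, and they increase with the
position. A finite chain has only one increasing enumeration, so one word determines the word at
every position. -/
theorem orbitWord_injective {σ σ' : Equiv.Perm (Fin n)} (hσ : σ.IsCycleOn Set.univ)
    (hσ' : σ'.IsCycleOn Set.univ) {s s' : Fin n → Fin N} (hs : CompatSeq (exd σ) s)
    (hs' : CompatSeq (exd σ') s') {i i' : Fin n} (h : orbitWord σ s i = orbitWord σ' s' i') :
    σ = σ' ∧ s = s' ∧ i = i' := by
  have hrange : ∀ {σ : Equiv.Perm (Fin n)} (_ : σ.IsCycleOn Set.univ) (s : Fin n → Fin N) (i),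
      Set.range (fun j => toLex (orbitWord σ s j)) =
        Set.range fun k => toLex (wordShift^[k] (orbitWord σ s i)) := by
    intro σ hσ s i
    refine Set.Subset.antisymm ?_ ?_
    · rintro _ ⟨j, rfl⟩
      obtain ⟨d, rfl⟩ := hσ.exists_pow_eq' Set.finite_univ (Set.mem_univ i) (Set.mem_univ j)
      exact ⟨d, by simp only [orbitWord_pow_apply]⟩
    · rintro _ ⟨k, rfl⟩
      exact ⟨(σ ^ k) i, by simp only [orbitWord_pow_apply]⟩
  have hm := strictMono_orbitWord hσ hs
  have hm' := strictMono_orbitWord hσ' hs'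
  have heq := (hm.range_inj hm').1 (by rw [hrange hσ s i, hrange hσ' s' i', h])
  have hall : ∀ j, orbitWord σ s j = orbitWord σ' s' j := fun j => congrFun heq j
  refine ⟨?_, ?_, ?_⟩
  · ext1 j
    refine hm'.injective ?_
    change orbitWord σ' s' (σ j) = orbitWord σ' s' (σ' j)
    rw [← hall, orbitWord_apply, orbitWord_apply, hall]
  · funext j
    exact congrArg Letter.val (congrFun (hall j) 0)
  · refine hm'.injective ?_
    change orbitWord σ' s' i = orbitWord σ' s' i'
    rw [← hall, h]

/-- The letters are constant up to the first change, and the adjacency rule for the colour of that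
constant letter fixes the direction of the change. Hence in the inverse construction the colours
mark the excedances. -/
theorem lt_wordShift_or {w : ℕ → Letter N} (hw : ValidWord w) (hne : wordShift w ≠ w) :
    ((w 0).color = false → toLex w < toLex (wordShift w)) ∧
      ((w 0).color = true → toLex (wordShift w) < toLex w) := by
  classical
  have hex : ∃ k, w (k + 1) ≠ w k := Function.ne_iff.1 hne
  set k := Nat.find hex
  have hk : w (k + 1) ≠ w k := Nat.find_spec hex
  have hlt : ∀ l < k, w (l + 1) = w l := fun l hl => not_not.1 (Nat.find_min hex hl)
  have h0 : ∀ l ≤ k, w l = w 0 := by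
    intro l
    induction l with
    | zero => exact fun _ => rfl
    | succ l ih => exact fun hl => (hlt l (by omega)).trans (ih (by omega))
  have hadj := hw k
  constructor
  · intro hc
    rw [← h0 k le_rfl] at hc
    refine ⟨k, fun l hl => (hlt l hl).symm, ?_⟩
    change w k < w (k + 1)
    rw [Letter.lt_iff]
    rcases (hadj.1 hc).lt_or_eq with h | h
    · exact Or.inl h
    · refine Or.inr ⟨h.symm, ?_⟩
      rw [hc]
      cases hc' : (w (k + 1)).color
      · exact absurd (Letter.ext_iff.2 ⟨h, hc'.trans hc.symm⟩) hk
      · exact Bool.false_lt_true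
  · intro hc
    rw [← h0 k le_rfl] at hc
    refine ⟨k, fun l hl => hlt l hl, ?_⟩
    change w (k + 1) < w k
    rw [Letter.lt_iff]
    rcases (hadj.2 hc).lt_or_eq with h | h
    · exact Or.inl h
    · refine Or.inr ⟨h.symm, ?_⟩
      rw [hc]
      cases hc' : (w (k + 1)).color
      · exact Bool.false_lt_true
      · exact absurd (Letter.ext_iff.2 ⟨h.symm, hc'.trans hc.symm⟩) hk

theorem lt_of_wordShift_lt {u v : ℕ → Letter N} (h0 : u 0 = v 0) (h : toLex u < toLex v) :
    toLex (wordShift u) < toLex (wordShift v) := by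
  obtain ⟨k, h1, h2⟩ := h
  rcases k with _ | k
  · exact absurd h2 (by simp [h0])
  · exact ⟨k, fun l hl => h1 (l + 1) (by omega), h2⟩

theorem apply_zero_le {u v : ℕ → Letter N} (h : toLex u ≤ toLex v) : u 0 ≤ v 0 :=
  Pi.apply_le_of_toLex h fun j hj => absurd hj (Nat.not_lt_zero j)

/-- Inverse construction: list the $n$ distinct rotations in lexicographic order. Shifting permutes
them, giving $\sigma$, and the first letters give $s$. -/
theorem exists_orbitWord_eq (hn : 2 ≤ n) {w : ℕ → Letter N} (hw : w ∈ primitiveWords N n) :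
    ∃ (σ : Equiv.Perm (Fin n)) (s : Fin n → Fin N) (i : Fin n),
      σ.IsCycleOn Set.univ ∧ CompatSeq (exd σ) s ∧ orbitWord σ s i = w := by
  classical
  obtain ⟨hn0, hval, hper⟩ := mem_primitiveWords.1 hw
  have hp : w ∈ Function.periodicPts wordShift :=
    Function.minimalPeriod_pos_iff_mem_periodicPts.1 (by omega)
  set O : Finset (Lex (ℕ → Letter N)) := (range n).image fun k => toLex (wordShift^[k] w) with hO
  have hcard : O.card = n := by
    rw [hO, card_image_of_injOn, card_range]
    intro a ha b hb hab
    have hinj := Function.iterate_injOn_Iio_minimalPeriod (f := wordShift) (x := w)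
    rw [hper] at hinj
    exact hinj (by simpa using ha) (by simpa using hb) (toLex.injective hab)
  have hmem : ∀ u, u ∈ O ↔ ∃ k, toLex (wordShift^[k] w) = u := by
    intro u
    rw [hO, mem_image]
    constructor
    · rintro ⟨k, -, h⟩
      exact ⟨k, h⟩
    · rintro ⟨k, rfl⟩
      refine ⟨k % n, mem_range.2 (Nat.mod_lt _ hn0), ?_⟩
      rw [← hper, Function.iterate_mod_minimalPeriod_eq]
  set e := O.orderIsoOfFin hcard with he
  set W : Fin n → ℕ → Letter N := fun i => ofLex (e i).1 with hW
  have hWmem : ∀ i, ∃ k, wordShift^[k] w = W i := fun i => (hmem _).1 (e i).2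
  have hWlt : ∀ {i j}, toLex (W i) < toLex (W j) ↔ i < j := fun {i j} => e.lt_iff_lt
  have hWle : ∀ {i j}, toLex (W i) ≤ toLex (W j) ↔ i ≤ j := fun {i j} => e.le_iff_le
  have hWinj : Function.Injective W := fun i j h => e.injective (Subtype.ext h)
  have hWsurj : ∀ k, ∃ i, W i = wordShift^[k] w := fun k => by
    obtain ⟨i, hi⟩ := e.surjective ⟨_, (hmem _).2 ⟨k, rfl⟩⟩
    exact ⟨i, congrArg Subtype.val hi⟩
  have hnext : ∀ i, ∃ j, W j = wordShift (W i) := by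
    intro i
    obtain ⟨k, hk⟩ := hWmem i
    obtain ⟨j, hj⟩ := hWsurj (k + 1)
    exact ⟨j, by rw [hj, ← hk, Function.iterate_succ_apply']⟩
  choose f hf using hnext
  have hfinj : Function.Injective f := by
    intro i j hij
    have h1 : wordShift (W i) = wordShift (W j) := by rw [← hf, ← hf, hij]
    have hback : ∀ i, wordShift^[n - 1] (wordShift (W i)) = W i := by
      intro i
      obtain ⟨k, hk⟩ := hWmem i
      rw [← Function.iterate_succ_apply, Nat.succ_eq_add_one, Nat.sub_add_cancel hn0, ← hk]
      have : Function.IsPeriodicPt wordShift n (wordShift^[k] w) :=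
        (hper ▸ Function.isPeriodicPt_minimalPeriod wordShift w).apply_iterate k
      exact this
    exact hWinj (by rw [← hback i, h1, hback])
  set σ : Equiv.Perm (Fin n) := Equiv.ofBijective f (Finite.injective_iff_bijective.1 hfinj)
  have hσ : ∀ i, W (σ i) = wordShift (W i) := hf
  have hσk : ∀ k i, W ((σ ^ k) i) = wordShift^[k] (W i) := by
    intro k i
    induction k with
    | zero => rfl
    | succ k ih => rw [pow_succ', Equiv.Perm.mul_apply, hσ, ih, Function.iterate_succ_apply']
  set s : Fin n → Fin N := fun i => (W i 0).val with hs
  have hvalid : ∀ i, ValidWord (W i) := by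
    intro i m
    obtain ⟨k, hk⟩ := hWmem i
    rw [← hk, wordShift_iterate, wordShift_iterate]
    have := hval (m + k)
    rwa [show m + k + 1 = m + 1 + k by omega] at this
  -- Here $n\ge2$ enters: a constant word has minimal period $1$, and its colour would not be
  -- determined by a comparison with its shift.
  have hne : ∀ i, wordShift (W i) ≠ W i := by
    intro i h
    obtain ⟨k, hk⟩ := hWmem i
    have h1 : Function.minimalPeriod wordShift (W i) = n := by
      rw [← hk, Function.minimalPeriod_apply_iterate hp, hper]
    have h2 : Function.IsPeriodicPt wordShift 1 (W i) := h
    have := h2.minimalPeriod_le Nat.one_pos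
    omega
  have hcol : ∀ i, (W i 0).color = decide (σ i ≤ i) := by
    intro i
    obtain ⟨h1, h2⟩ := lt_wordShift_or (hvalid i) (hne i)
    rw [← hσ, hWlt] at h1 h2
    cases hc : (W i 0).color
    · simpa using h1 hc
    · simpa using (h2 hc).le
  have hletter : ∀ i, letterAt σ s i = W i 0 := fun i =>
    Letter.ext_iff.2 ⟨rfl, (hcol i).symm⟩
  obtain ⟨i₀, hi₀⟩ := hWsurj 0
  refine ⟨σ, s, i₀, ⟨?_, ?_⟩, ⟨?_, ?_⟩, ?_⟩
  · simp [Set.bijOn_univ]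
  · have hsame : ∀ i, σ.SameCycle i₀ i := by
      intro i
      obtain ⟨k, hk⟩ := hWmem i
      refine ⟨k, hWinj ?_⟩
      rw [zpow_natCast, hσk, hi₀, ← hk]
      rfl
    exact fun i _ j _ => (hsame i).symm.trans (hsame j)
  · intro i j hij
    have h1 : W i 0 ≤ W j 0 := apply_zero_le (hWle.2 hij)
    rcases h1.lt_or_eq with h | h
    · rcases Letter.lt_iff.1 h with h | h
      · exact h.le
      · exact h.1.ge
    · exact (congrArg Letter.val h).ge
  · intro i hi hd
    obtain ⟨_, hd⟩ := hd
    set a : Fin n := ⟨i, Nat.lt_of_succ_lt hi⟩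
    set b : Fin n := ⟨i + 1, hi⟩
    have hab : a < b := Fin.lt_def.2 (Nat.lt_succ_self i)
    rcases (apply_zero_le (hWle.2 hab.le)).lt_or_eq with h | h
    · rcases Letter.lt_iff.1 h with h | ⟨h1, h2⟩
      · exact h
      · exfalso
        rw [hcol, hcol] at h2
        rcases Prod.Lex.lt_iff.1 hd with h3 | ⟨h3, -⟩
        · exact absurd h2 h3.not_gt
        · exact absurd h3 h2.ne'
    · exfalso
      -- Equal first letters leave the order of the rotations to their shifts, so
      -- $\sigma(a)<\sigma(b)$. With equal colours this contradicts a descent of the barred word.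
      have h1 := lt_of_wordShift_lt h (hWlt.2 hab)
      rw [← hσ, ← hσ, hWlt] at h1
      have h2 : decide (σ a ≤ a) = decide (σ b ≤ b) := by rw [← hcol, ← hcol, h]
      rcases Prod.Lex.lt_iff.1 hd with h3 | ⟨-, h3⟩
      · exact absurd h2 h3.ne'
      · exact absurd h1 h3.not_gt
  · funext k
    rw [orbitWord, hletter, hσk, hi₀, Function.iterate_zero, id, wordShift_iterate, zero_add]

variable {R : Type*} [CommRing R]

theorem prod_weight_orbitWord {σ : Equiv.Perm (Fin n)} (hσ : σ.IsCycleOn Set.univ)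
    (s : Fin n → Fin N) (i : Fin n) (x : Fin N → R) (t : R) :
    ∏ k ∈ range n, (orbitWord σ s i k).weight x t = t ^ exc σ * ∏ j, x (s j) := by
  have hσ' : σ.IsCycleOn ((univ : Finset (Fin n)) : Set (Fin n)) := by simpa using hσ
  have hinj : Function.Injective fun k : Fin n => (σ ^ (k : ℕ)) i := by
    intro k l h
    have := (hσ'.pow_apply_eq_pow_apply (mem_univ i)).1 h
    rw [card_univ, Fintype.card_fin] at this
    exact Fin.ext (Nat.ModEq.eq_of_lt_of_lt this k.2 l.2)
  rw [prod_range]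
  refine ((Finite.injective_iff_bijective.1 hinj).prod_comp
    (fun j => (letterAt σ s j).weight x t)).trans ?_
  simp only [Letter.weight, letterAt, Letter.val_mk, Letter.color_mk, decide_eq_true_eq,
    prod_mul_distrib]
  rw [prod_ite, prod_const_one, prod_const, one_mul, mul_comm]
  simp only [not_le]
  rfl

-- The factor $n$ counts the starting points: a pair $(\sigma,s)$ yields $n$ distinct rotations.
open Classical in
theorem natCast_mul_sum_eq_primitiveSum (hn : 2 ≤ n) (x : Fin N → R) (t : R) :
    (n : R) * ∑ σ : Equiv.Perm (Fin n) with σ.IsCycleOn Set.univ,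
      t ^ exc σ * ∑ s : Fin n → Fin N with CompatSeq (exd σ) s, ∏ j, x (s j) =
      primitiveSum n x t := by
  have h1 : primitiveSum n x t = ∑ p ∈ (univ.filter fun p :
      Equiv.Perm (Fin n) × (Fin n → Fin N) × Fin n =>
        p.1.IsCycleOn Set.univ ∧ CompatSeq (exd p.1) p.2.1), t ^ exc p.1 * ∏ j, x (p.2.1 j) := by
    symm
    refine sum_bij (fun p _ => orbitWord p.1 p.2.1 p.2.2) ?_ ?_ ?_ ?_
    · intro p hp
      obtain ⟨h1, h2⟩ := (mem_filter.1 hp).2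
      exact mem_primitiveWords.2 ⟨by omega, validWord_orbitWord h2.1 _,
        minimalPeriod_orbitWord h1 h2 _⟩
    · rintro ⟨σ, s, i⟩ hp ⟨σ', s', i'⟩ hp' h
      obtain ⟨h1, h2⟩ := (mem_filter.1 hp).2
      obtain ⟨h1', h2'⟩ := (mem_filter.1 hp').2
      obtain ⟨rfl, rfl, rfl⟩ := orbitWord_injective h1 h1' h2 h2' h
      rfl
    · intro w hw
      obtain ⟨σ, s, i, h1, h2, h3⟩ := exists_orbitWord_eq hn hw
      exact ⟨(σ, s, i), mem_filter.2 ⟨mem_univ _, h1, h2⟩, h3⟩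
    · intro p hp
      rw [prod_weight_orbitWord (mem_filter.1 hp).2.1]
  rw [h1, sum_filter, sum_filter, mul_sum, Fintype.sum_prod_type]
  refine sum_congr rfl fun σ _ => ?_
  rw [Fintype.sum_prod_type]
  split_ifs with hσ
  · rw [mul_sum, mul_sum, sum_filter]
    refine sum_congr rfl fun s _ => ?_
    simp [hσ]
  · simp [hσ]

end OrbitWords

/-! ### The power sum expansion of the sums over primitive words -/

/-- The partition of `n` obtained from a partition of `d` by multiplying all parts with `e`. -/
def scalePartition {n d e : ℕ} (he : 0 < e) (h : d * e = n) (mu : d.Partition) : n.Partition where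
  parts := mu.parts.map (e * ·)
  parts_pos := by
    intro i hi
    obtain ⟨j, hj, rfl⟩ := Multiset.mem_map.1 hi
    exact Nat.mul_pos he (mu.parts_pos hj)
  parts_sum := by
    rw [Multiset.sum_map_mul_left, Multiset.map_id', mu.parts_sum, mul_comm, h]

/-- Strong induction over the divisors. The coefficients `q` must not depend on `N`, `R`, `x` or
`t`, because the expansion for $d$ is used at $x^{n/d},t^{n/d}$. For the same reason all powers of
$t$ must differ from $1$. -/
theorem exists_primitiveSum_eq (n : ℕ) (hn : 0 < n) : ∃ q : n.Partition → ℚ[X],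
    (2 ≤ n → ∀ lam, 1 ∈ lam.parts →
      q lam = C ((n : ℚ) * (zee lam : ℚ)⁻¹) * (cyclePoly lam).map (algebraMap ℤ ℚ)) ∧
    ∀ (N : ℕ) (R : Type) [CommRing R] [IsDomain R] [Algebra ℚ R] (x : Fin N → R) (t : R),
      (∀ d, 0 < d → t ^ d ≠ 1) → primitiveSum n x t =
        ∑ lam, aeval t (q lam) * (lam.parts.map fun l => ∑ a, x a ^ l).prod := by
  classical
  induction n using Nat.strong_induction_on with
  | _ n ih =>
  have ih' : ∀ d : n.properDivisors, ∃ q : d.1.Partition → ℚ[X],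
      ∀ (N : ℕ) (R : Type) [CommRing R] [IsDomain R] [Algebra ℚ R] (x : Fin N → R) (t : R),
      (∀ d, 0 < d → t ^ d ≠ 1) → primitiveSum d.1 x t =
        ∑ lam, aeval t (q lam) * (lam.parts.map fun l => ∑ a, x a ^ l).prod := by
    intro d
    obtain ⟨q, -, hq⟩ := ih d.1 (Nat.mem_properDivisors.1 d.2).2
      (Nat.pos_of_dvd_of_pos (Nat.mem_properDivisors.1 d.2).1 hn)
    exact ⟨q, hq⟩
  choose q hq using ih'
  have hmul : ∀ d : n.properDivisors, d.1 * (n / d.1) = n := fun d =>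
    Nat.mul_div_cancel' (Nat.mem_properDivisors.1 d.2).1
  have he : ∀ d : n.properDivisors, 2 ≤ n / d.1 := by
    intro d
    by_contra h
    have h1 := hmul d
    have h2 := (Nat.mem_properDivisors.1 d.2).2
    have h3 : n / d.1 ≤ 1 := by omega
    have := Nat.mul_le_mul_left d.1 h3
    omega
  have he0 : ∀ d : n.properDivisors, 0 < n / d.1 := fun d => (Nat.zero_lt_two).trans_le (he d)
  -- The coefficient of $p_\lambda$ in the trace, minus the contributions of proper divisors.
  -- Replacing $x,t$ by their $(n/d)$-th powers scales the parts of $\mu$ and expands the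
  -- coefficient polynomial.
  refine ⟨fun lam => (if lam = Nat.Partition.indiscrete n then 1 else 0) +
    C ((n : ℚ) * (zee lam : ℚ)⁻¹) * (cyclePoly lam).map (algebraMap ℤ ℚ) -
    ∑ d : n.properDivisors, ∑ mu : d.1.Partition,
      if scalePartition (he0 d) (hmul d) mu = lam then expand ℚ (n / d.1) (q d mu) else 0, ?_, ?_⟩
  · intro hn2 lam hlam
    beta_reduce
    rw [if_neg, sum_eq_zero, zero_add, sub_zero]
    · intro d _
      refine sum_eq_zero fun mu _ => if_neg ?_
      rintro rfl
      obtain ⟨j, -, hj⟩ := Multiset.mem_map.1 hlam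
      have := Nat.eq_one_of_mul_eq_one_right hj
      have := he d
      omega
    · rintro rfl
      rw [Nat.Partition.indiscrete_parts hn.ne', Multiset.mem_singleton] at hlam
      omega
  · intro N R _ _ _ x t ht
    have hW := sum_validWords hn x t
    rw [← Nat.cons_self_properDivisors hn.ne', sum_cons, Nat.div_self hn, sum_validWords_eq_trace hn,
      trace_transferMatrix_pow x (by simpa using ht 1 Nat.one_pos)] at hW
    simp only [pow_one] at hW
    rw [eq_sub_of_add_eq hW.symm]
    simp only [map_sub, map_add, sub_mul, add_mul, sum_sub_distrib, sum_add_distrib]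
    congr 1
    · congr 1
      · rw [sum_eq_single (Nat.Partition.indiscrete n)]
        · simp [Nat.Partition.indiscrete_parts hn.ne']
        · intro lam _ h
          simp [h]
        · simp
      · rw [partSum, mul_sum]
        refine sum_congr rfl fun lam _ => ?_
        rw [Multiset.prod_map_mul, cyclePoly]
        simp only [map_mul, aeval_C, aeval_map_algebraMap, aeval_X, map_multiset_prod,
          Multiset.map_map, Function.comp_def, map_natCast, Algebra.smul_def]
        ring
    · rw [← sum_coe_sort]
      simp only [map_sum, sum_mul]
      rw [sum_comm]
      refine sum_congr rfl fun d _ => ?_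
      rw [hq d N R _ _ (fun k hk => by
        rw [← pow_mul]
        exact ht _ (Nat.mul_pos (he0 d) hk)), sum_comm]
      refine sum_congr rfl fun mu _ => ?_
      rw [sum_eq_single (scalePartition (he0 d) (hmul d) mu)]
      · rw [if_pos rfl, expand_aeval]
        simp only [scalePartition, Multiset.map_map, Function.comp_def, ← pow_mul]
      · intro lam _ h
        rw [if_neg h.symm, map_zero, zero_mul]
      · simp

open Classical in
/-- The truncation of `Q_{(n),j}` to `N` variables. -/
noncomputable def cycleQ (R : Type*) [CommRing R] (N n j : ℕ) : MvPolynomial (Fin N) R :=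
  ∑ σ : Equiv.Perm (Fin n) with exc σ = j ∧ σ.IsCycleOn Set.univ,
    ∑ s : Fin n → Fin N with CompatSeq (exd σ) s, ∏ i, MvPolynomial.X (s i)

theorem exists_cycleQ_eq {n : ℕ} (hn : 2 ≤ n) (j : ℕ) : ∃ a : n.Partition → ℂ,
    (∀ lam, 1 ∈ lam.parts → a lam = (zee lam : ℂ)⁻¹ * ((cyclePoly lam).coeff j : ℂ)) ∧
    ∀ N, cycleQ ℂ N n j =
      ∑ lam, a lam • (lam.parts.map (MvPolynomial.psum (Fin N) ℂ)).prod := by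
  classical
  obtain ⟨q, h1, h2⟩ := exists_primitiveSum_eq n (by omega)
  have hn0 : (n : ℂ) ≠ 0 := by
    have : n ≠ 0 := by omega
    exact_mod_cast this
  refine ⟨fun lam => (n : ℂ)⁻¹ * ((q lam).coeff j : ℂ), ?_, ?_⟩
  · intro lam hlam
    beta_reduce
    rw [h1 hn lam hlam, coeff_C_mul, coeff_map]
    push_cast
    rw [mul_assoc, inv_mul_cancel_left₀ hn0]
    simp
  · intro N
    -- Taking $t$ to be an indeterminate makes $t^d\ne1$ automatic and allows the coefficient of
    -- $t^j$ to be extracted.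
    have h3 := h2 N (Polynomial (MvPolynomial (Fin N) ℂ)) (fun a => C (MvPolynomial.X a)) X
      (fun d hd h => by
        have := congrArg natDegree h
        simp at this
        omega)
    rw [← natCast_mul_sum_eq_primitiveSum hn] at h3
    have h4 := congrArg (fun p => coeff p j) h3
    simp only [finsetSum_coeff] at h4
    rw [← map_natCast C, coeff_C_mul, finsetSum_coeff] at h4
    have h5 : ∀ σ : Equiv.Perm (Fin n), coeff (X ^ exc σ *
        ∑ s : Fin n → Fin N with CompatSeq (exd σ) s,
          ∏ i, C (MvPolynomial.X (s i) : MvPolynomial (Fin N) ℂ)) j =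
        if exc σ = j then ∑ s : Fin n → Fin N with CompatSeq (exd σ) s,
          ∏ i, MvPolynomial.X (s i) else 0 := by
      intro σ
      simp only [← map_prod, ← map_sum]
      rw [coeff_mul_C, coeff_X_pow]
      simp [eq_comm]
    have h6 : ∀ lam : n.Partition, coeff (aeval (X : Polynomial (MvPolynomial (Fin N) ℂ)) (q lam) *
        (lam.parts.map fun l => ∑ a, C (MvPolynomial.X a : MvPolynomial (Fin N) ℂ) ^ l).prod) j =
        ((q lam).coeff j : ℂ) • (lam.parts.map (MvPolynomial.psum (Fin N) ℂ)).prod := by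
      intro lam
      have e1 : (lam.parts.map fun l => ∑ a, C (MvPolynomial.X a : MvPolynomial (Fin N) ℂ) ^ l).prod
          = C (lam.parts.map (MvPolynomial.psum (Fin N) ℂ)).prod := by
        rw [map_multiset_prod, Multiset.map_map]
        simp [MvPolynomial.psum, Function.comp_def]
      have e2 : coeff (aeval (X : Polynomial (MvPolynomial (Fin N) ℂ)) (q lam)) j =
          algebraMap ℚ _ ((q lam).coeff j) := by
        rw [← coeff_map, aeval_X_left_eq_map]
      rw [e1, coeff_mul_C, e2, Algebra.smul_def]
      congr 1
    rw [sum_congr rfl fun σ _ => h5 σ, sum_congr rfl fun lam _ => h6 lam] at h4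
    have h7 : cycleQ ℂ N n j = ∑ σ : Equiv.Perm (Fin n) with σ.IsCycleOn Set.univ,
        if exc σ = j then ∑ s : Fin n → Fin N with CompatSeq (exd σ) s,
          ∏ i, MvPolynomial.X (s i) else 0 := by
      rw [cycleQ, ← sum_filter, filter_filter]
      simp only [and_comm]
    rw [← h7] at h4
    simp only [mul_smul, ← smul_sum]
    rw [← h4, MvPolynomial.smul_eq_C_mul, ← mul_assoc, ← map_natCast MvPolynomial.C,
      ← map_mul, inv_mul_cancel₀ hn0, map_one, one_mul]

end

/-! ### Invariant colourings and power sums -/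

section Colourings

variable {n : ℕ}

open Classical in
theorem prod_cycles_eq_prod_parts {R : Type*} [CommRing R] (σ : Equiv.Perm (Fin n)) (f : ℕ → R) :
    ∏ z : Quotient (Equiv.Perm.SameCycle.setoid σ),
      f (univ.filter fun i => (Quotient.mk _ i : Quotient (Equiv.Perm.SameCycle.setoid σ)) = z).card
      = ((cycleShape σ).parts.map f).prod := by
  set S := Equiv.Perm.SameCycle.setoid σ
  have hmk : ∀ i j : Fin n, (Quotient.mk S i = Quotient.mk S j) ↔ σ.SameCycle i j :=
    fun i j => Quotient.eq
  let m : Quotient S → Equiv.Perm (Fin n) :=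
    Quotient.lift (fun i => σ.cycleOf i) fun i j h => Equiv.Perm.SameCycle.cycleOf_eq h
  have hm : ∀ i, m (Quotient.mk S i) = σ.cycleOf i := fun _ => rfl
  have hparts : (cycleShape σ).parts =
      σ.cycleType + Multiset.replicate (Fintype.card (Fin n) - σ.support.card) 1 := rfl
  rw [hparts, Multiset.map_add, Multiset.prod_add, Multiset.map_replicate,
    Multiset.prod_replicate, Equiv.Perm.cycleType_def, Multiset.map_map,
    ← prod_filter_not_mul_prod_filter univ (fun z => m z = 1)]
  congr 1
  · refine prod_bij (fun z _ => m z) ?_ ?_ ?_ ?_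
    · intro z hz
      induction z using Quotient.inductionOn with
      | _ i =>
      rw [mem_filter, hm, Equiv.Perm.cycleOf_eq_one_iff] at hz
      exact Equiv.Perm.cycleOf_mem_cycleFactorsFinset_iff.2 (Equiv.Perm.mem_support.2 hz.2)
    · intro z hz z' hz' h
      induction z using Quotient.inductionOn with
      | _ i =>
      induction z' using Quotient.inductionOn with
      | _ j =>
      rw [mem_filter, hm, Equiv.Perm.cycleOf_eq_one_iff] at hz
      rw [hm, hm] at h
      have hi := Equiv.Perm.mem_support.2 hz.2
      have : i ∈ (σ.cycleOf j).support := by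
        rw [← h, Equiv.Perm.mem_support_cycleOf_iff]
        exact ⟨Equiv.Perm.SameCycle.refl _ _, hi⟩
      exact (hmk i j).2 (Equiv.Perm.mem_support_cycleOf_iff.1 this).1.symm
    · intro c hc
      obtain ⟨i, hi⟩ := Equiv.Perm.IsCycle.nonempty_support
        (Equiv.Perm.mem_cycleFactorsFinset_iff.1 hc).1
      have h1 := Equiv.Perm.cycle_is_cycleOf hi hc
      refine ⟨Quotient.mk S i, ?_, h1.symm⟩
      rw [mem_filter, hm, ← h1]
      exact ⟨mem_univ _, (Equiv.Perm.mem_cycleFactorsFinset_iff.1 hc).1.ne_one⟩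
    · intro z hz
      induction z using Quotient.inductionOn with
      | _ i =>
      rw [mem_filter, hm, Equiv.Perm.cycleOf_eq_one_iff] at hz
      rw [hm, Function.comp_apply, Function.comp_apply]
      congr 2
      ext j
      rw [mem_filter, hmk, Equiv.Perm.mem_support_cycleOf_iff]
      exact ⟨fun h => ⟨h.2.symm, Equiv.Perm.mem_support.2 hz.2⟩, fun h => ⟨mem_univ _, h.1.symm⟩⟩
  · have h1 : ∀ z ∈ univ.filter (fun z => m z = 1),
        f (univ.filter fun i => Quotient.mk S i = z).card = f 1 := by
      intro z hz
      induction z using Quotient.inductionOn with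
      | _ i =>
      rw [mem_filter, hm, Equiv.Perm.cycleOf_eq_one_iff] at hz
      have : (univ.filter fun j => Quotient.mk S j = Quotient.mk S i) = {i} := by
        ext j
        rw [mem_filter, hmk, mem_singleton]
        constructor
        · rintro ⟨-, h⟩
          exact (h.symm.eq_of_left hz.2).symm
        · rintro rfl
          exact ⟨mem_univ _, Equiv.Perm.SameCycle.refl _ _⟩
      rw [this, card_singleton]
    rw [prod_congr rfl h1, prod_const]
    congr 1
    rw [← card_compl]
    symm
    refine card_bij (fun i _ => Quotient.mk S i) ?_ ?_ ?_
    · intro i hi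
      rw [mem_filter, hm, Equiv.Perm.cycleOf_eq_one_iff]
      exact ⟨mem_univ _, by simpa using hi⟩
    · intro i hi j hj h
      have hi' : σ i = i := by simpa using hi
      exact ((hmk i j).1 h).eq_of_left hi'
    · intro z hz
      induction z using Quotient.inductionOn with
      | _ i =>
      rw [mem_filter, hm, Equiv.Perm.cycleOf_eq_one_iff] at hz
      exact ⟨i, by simpa using hz.2, rfl⟩

/-- An invariant colouring is a free choice of one colour per cycle, and a cycle of length $l$ with
colour $b$ contributes $y_b^l$. -/
theorem sum_invariant_colourings {R B : Type*} [CommRing R] [Fintype B] [DecidableEq B]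
    (σ : Equiv.Perm (Fin n)) (y : B → R) :
    ∑ c : Fin n → B with c ∘ σ = c, ∏ i, y (c i) =
      ((cycleShape σ).parts.map fun l => ∑ b, y b ^ l).prod := by
  classical
  set S := Equiv.Perm.SameCycle.setoid σ
  rw [← prod_cycles_eq_prod_parts, prod_univ_sum, Fintype.piFinset_univ]
  symm
  refine sum_bij (fun (d : Quotient S → B) _ => fun i => d (Quotient.mk S i)) ?_ ?_ ?_ ?_
  · intro d _
    rw [mem_filter]
    refine ⟨mem_univ _, funext fun i => congrArg d (Quotient.sound ?_)⟩
    exact Equiv.Perm.sameCycle_apply_left.2 (Equiv.Perm.SameCycle.refl _ _)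
  · intro d _ d' _ h
    funext z
    induction z using Quotient.inductionOn with
    | _ i => exact congrFun h i
  · intro c hc
    have hc' := (mem_filter.1 hc).2
    have hk : ∀ (k : ℤ) (i : Fin n), c ((σ ^ k) i) = c i := by
      intro k i
      have : ∀ i, c (σ i) = c i := congrFun hc'
      induction k using Int.induction_on generalizing i with
      | zero => rfl
      | succ k ih => rw [zpow_add_one, Equiv.Perm.mul_apply, ih, this]
      | pred k ih => rw [zpow_sub_one, Equiv.Perm.mul_apply, ih, ← this (σ⁻¹ i),
          ← Equiv.Perm.mul_apply, mul_inv_cancel, Equiv.Perm.one_apply]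
    refine ⟨Quotient.lift c ?_, mem_univ _, rfl⟩
    rintro i j ⟨k, rfl⟩
    exact (hk k i).symm
  · intro d _
    rw [← prod_fiberwise univ (fun i => Quotient.mk S i)]
    refine prod_congr rfl fun z _ => ?_
    have : ∀ i ∈ univ.filter (fun i => Quotient.mk S i = z), y (d (Quotient.mk S i)) = y (d z) :=
      fun i hi => by rw [(mem_filter.1 hi).2]
    rw [prod_congr rfl this, prod_const]

theorem sign_eq_prod_parts (σ : Equiv.Perm (Fin n)) :
    ((Equiv.Perm.sign σ : ℤ)) = ((cycleShape σ).parts.map fun l => -(-1 : ℤ) ^ l).prod := by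
  have hparts : (cycleShape σ).parts =
      σ.cycleType + Multiset.replicate (Fintype.card (Fin n) - σ.support.card) 1 := rfl
  rw [hparts, Multiset.map_add, Multiset.prod_add, Multiset.map_replicate,
    Multiset.prod_replicate]
  have h := congrArg (Units.coeHom ℤ) (Equiv.Perm.sign_of_cycleType' σ)
  rw [map_multiset_prod, Multiset.map_map] at h
  refine h.trans ?_
  simp [Function.comp_def]

end Colourings

/-! ### The signed permutation representation on colourings of given content -/

section ColourRep

variable {n : ℕ} {B : Type} [Fintype B] [DecidableEq B]

/-- Colourings of `[n]` in which the colour `b` is used `κ b` times. -/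
abbrev Colouring (n : ℕ) (κ : B → ℕ) := {c : Fin n → B // ∀ b, #{i | c i = b} = κ b}

/-- Precomposition of a colouring with a permutation. -/
def Colouring.comp {κ : B → ℕ} (c : Colouring n κ) (σ : Equiv.Perm (Fin n)) : Colouring n κ :=
  ⟨c.1 ∘ σ, fun b => by
    rw [← c.2 b]
    exact card_equiv σ (by simp)⟩

/-- The permutation representation on colourings, twisted by the sign. -/
def colourRep (n : ℕ) (κ : B → ℕ) :
    Representation ℂ (Equiv.Perm (Fin n)) (Colouring n κ → ℂ) where
  toFun σ :=
    { toFun := fun f c => ((Equiv.Perm.sign σ : ℤ) : ℂ) * f (c.comp σ)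
      map_add' := fun f g => by
        funext c
        simp [mul_add]
      map_smul' := fun r f => by
        funext c
        simp [mul_left_comm] }
  map_one' := by
    refine LinearMap.ext fun f => funext fun c => ?_
    simp [Colouring.comp]
  map_mul' σ τ := by
    refine LinearMap.ext fun f => funext fun c => ?_
    have : (c.comp σ).comp τ = c.comp (σ * τ) := rfl
    simp [this, mul_assoc]

theorem trace_colourRep (κ : B → ℕ) (σ : Equiv.Perm (Fin n)) :
    LinearMap.trace ℂ _ (colourRep n κ σ) =
      ((Equiv.Perm.sign σ : ℤ) : ℂ) * #{c : Colouring n κ | c.comp σ = c} := by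
  rw [LinearMap.trace_eq_matrix_trace ℂ (Pi.basisFun ℂ _), Matrix.trace]
  have h : ∀ c : Colouring n κ, (LinearMap.toMatrix (Pi.basisFun ℂ (Colouring n κ))
      (Pi.basisFun ℂ (Colouring n κ)) (colourRep n κ σ)).diag c =
      ((Equiv.Perm.sign σ : ℤ) : ℂ) * if c.comp σ = c then 1 else 0 := by
    intro c
    rw [Matrix.diag_apply, LinearMap.toMatrix_apply, Pi.basisFun_apply, Pi.basisFun_repr]
    change _ * (Pi.single c (1 : ℂ) : Colouring n κ → ℂ) (c.comp σ) = _
    rw [Pi.single_apply]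
  rw [sum_congr rfl fun c _ => h c, ← mul_sum, sum_boole]

/-- The signed colouring representation as an object of `FDRep`. -/
noncomputable def colourFDRep (n : ℕ) (κ : B → ℕ) : FDRep ℂ (Equiv.Perm (Fin n)) :=
  FDRep.of (colourRep n κ)

theorem character_colourFDRep (κ : B → ℕ) (σ : Equiv.Perm (Fin n)) :
    (colourFDRep n κ).character σ =
      ((Equiv.Perm.sign σ : ℤ) : ℂ) * #{c : Colouring n κ | c.comp σ = c} :=
  trace_colourRep κ σ

end ColourRep

/-! ### The dual Cauchy identity -/

section Cauchy

/-- Newton's identities for $e_n$ are the recurrence `natCast_mul_partSum` with constant `f` and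
signed power sums. -/
theorem sum_powersetCard_eq_partSum {σ A : Type*} [Fintype σ] [CommRing A] [Algebra ℚ A]
    [IsDomain A] (v : σ → A) (n : ℕ) :
    ∑ T ∈ powersetCard n univ, ∏ a ∈ T, v a =
      partSum (fun _ => 1) (fun l => -(-1) ^ l * ∑ a, v a ^ l) n := by
  have := algebraRat.charZero A
  classical
  have he : ∀ n, MvPolynomial.aeval v (MvPolynomial.esymm σ ℤ n) =
      ∑ T ∈ powersetCard n univ, ∏ a ∈ T, v a := fun n => by simp [MvPolynomial.esymm]
  induction n using Nat.strong_induction_on with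
  | _ n ih =>
  rcases Nat.eq_zero_or_pos n with rfl | hn
  · simp [partSum_zero]
  have hn0 : (n : A) ≠ 0 := by exact_mod_cast hn.ne'
  refine mul_left_cancel₀ hn0 ?_
  rw [natCast_mul_partSum]
  have h := congrArg (MvPolynomial.aeval v) (MvPolynomial.mul_esymm_eq_sum σ ℤ n)
  simp only [map_mul, map_natCast, map_sum, map_pow, map_neg, map_one, he] at h
  rw [h, mul_sum]
  refine sum_bij' (fun p _ => p.2) (fun l _ => (n - l, l)) ?_ ?_ ?_ ?_ ?_
  · intro p hp
    rw [mem_filter, HasAntidiagonal.mem_antidiagonal] at hp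
    exact mem_Icc.2 (by omega)
  · intro l hl
    rw [mem_Icc] at hl
    rw [mem_filter, HasAntidiagonal.mem_antidiagonal]
    simp only
    omega
  · intro p hp
    rw [mem_filter, HasAntidiagonal.mem_antidiagonal] at hp
    exact Prod.ext (by simp only; omega) rfl
  · intro l _
    rfl
  · rintro ⟨k, l⟩ hp
    rw [mem_filter, HasAntidiagonal.mem_antidiagonal] at hp
    simp only at hp ⊢
    obtain ⟨rfl, hk⟩ := hp
    rw [ih k hk, Nat.add_sub_cancel, MvPolynomial.psum, map_sum]
    simp only [map_pow, MvPolynomial.aeval_X]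
    have : (-1 : A) ^ (k + l + 1) * (-1) ^ k = -(-1) ^ l := by
      rw [pow_succ, pow_add]
      have : (-1 : A) ^ k * (-1) ^ k = 1 := by rw [← mul_pow]; simp
      linear_combination (-(-1 : A) ^ l) * this
    linear_combination (partSum (fun _ => 1) (fun l => -(-1) ^ l * ∑ a, v a ^ l) k *
      ∑ a, v a ^ l) * this

theorem prod_map_signed_sum {B : Type} [Fintype B] (N : ℕ) (M : Multiset ℕ) :
    (M.map fun l => -(-1) ^ l * ∑ p : Fin N × B,
      (MvPolynomial.C (MvPolynomial.X p.1) * MvPolynomial.X p.2 :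
        MvPolynomial B (MvPolynomial (Fin N) ℂ)) ^ l).prod =
      MvPolynomial.C (MvPolynomial.C (((M.map fun l => -(-1 : ℤ) ^ l).prod : ℤ) : ℂ) *
        (M.map (MvPolynomial.psum (Fin N) ℂ)).prod) *
      (M.map fun l => ∑ b : B, (MvPolynomial.X b) ^ l).prod := by
  induction M using Multiset.induction_on with
  | empty => simp
  | cons l M ih =>
    simp only [Multiset.map_cons, Multiset.prod_cons]
    have h : ∑ p : Fin N × B, (MvPolynomial.C (MvPolynomial.X p.1) * MvPolynomial.X p.2 :
        MvPolynomial B (MvPolynomial (Fin N) ℂ)) ^ l =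
        MvPolynomial.C (MvPolynomial.psum (Fin N) ℂ l) * ∑ b : B, (MvPolynomial.X b) ^ l := by
      rw [Fintype.sum_prod_type, MvPolynomial.psum, map_sum, sum_mul_sum]
      simp only [mul_pow, map_pow]
    rw [ih, h]
    simp only [Int.cast_mul, Int.cast_neg, Int.cast_pow, Int.cast_one, map_mul, map_neg, map_pow,
      map_one]
    ring

variable {B : Type} [Fintype B] [DecidableEq B]

theorem sum_single_eq_iff {n : ℕ} (c : Fin n → B) (κ : B → ℕ) :
    ∑ i, Finsupp.single (c i) 1 = Finsupp.equivFunOnFinite.symm κ ↔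
      ∀ b, #{i | c i = b} = κ b := by
  rw [Finsupp.ext_iff]
  refine forall_congr' fun b => ?_
  rw [Finsupp.finsetSum_apply, card_filter]
  simp only [Finsupp.single_apply]
  rfl

theorem coeff_prod_one_add {S : Type*} [CommRing S] (N : ℕ) (x : Fin N → S) (κ : B → ℕ) :
    MvPolynomial.coeff (Finsupp.equivFunOnFinite.symm κ)
      (∏ p : Fin N × B, (1 + MvPolynomial.C (x p.1) * MvPolynomial.X p.2)) =
      ∏ b, ∑ T ∈ powersetCard (κ b) univ, ∏ a ∈ T, x a := by
  have h1 : ∀ b : B, ∏ a : Fin N, (1 + MvPolynomial.C (x a) * MvPolynomial.X b) =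
      ∑ k ∈ range (N + 1), MvPolynomial.C (∑ T ∈ powersetCard k univ, ∏ a ∈ T, x a) *
        (MvPolynomial.X b : MvPolynomial B S) ^ k := by
    intro b
    rw [prod_one_add, sum_powerset, card_univ, Fintype.card_fin]
    refine sum_congr rfl fun k _ => ?_
    rw [map_sum, sum_mul]
    refine sum_congr rfl fun T hT => ?_
    rw [prod_mul_distrib, prod_const, (mem_powersetCard.1 hT).2, map_prod]
  have h2 : ∀ k : B → ℕ, ∏ b, (MvPolynomial.C (∑ T ∈ powersetCard (k b) univ, ∏ a ∈ T, x a) *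
        (MvPolynomial.X b : MvPolynomial B S) ^ k b) =
      MvPolynomial.monomial (Finsupp.equivFunOnFinite.symm k)
        (∏ b, ∑ T ∈ powersetCard (k b) univ, ∏ a ∈ T, x a) := by
    intro k
    rw [prod_mul_distrib, ← map_prod, MvPolynomial.monomial_eq,
      Finsupp.prod_fintype _ _ (fun _ => pow_zero _)]
    rfl
  rw [Fintype.prod_prod_type_right, prod_congr rfl fun b _ => h1 b, prod_univ_sum,
    sum_congr rfl fun k _ => h2 k, MvPolynomial.coeff_sum]
  simp only [MvPolynomial.coeff_monomial, Finsupp.equivFunOnFinite.symm.injective.eq_iff]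
  rw [sum_ite_eq']
  split_ifs with h
  · rfl
  · simp only [Fintype.mem_piFinset, mem_range, not_forall, not_lt] at h
    obtain ⟨b, hb⟩ := h
    refine (prod_eq_zero (mem_univ b) ?_).symm
    rw [powersetCard_eq_empty.2, sum_empty]
    rw [card_univ, Fintype.card_fin]
    omega

/-- In $\prod_{a,b}(1+x_ay_b)$ the coefficient of $y^\kappa$ is $\prod_be_{\kappa_b}(x)$. Only sets
of $n$ pairs reach total $y$-degree $\sum_b\kappa_b=n$. -/
theorem coeff_sum_powersetCard {S : Type*} [CommRing S] {N n : ℕ} (x : Fin N → S) (κ : B → ℕ)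
    (hκ : ∑ b, κ b = n) :
    MvPolynomial.coeff (Finsupp.equivFunOnFinite.symm κ)
      (∑ T ∈ powersetCard n univ, ∏ p ∈ T,
        (MvPolynomial.C (x (Prod.fst p)) * MvPolynomial.X (Prod.snd p) : MvPolynomial B S)) =
      ∏ b, ∑ T ∈ powersetCard (κ b) univ, ∏ a ∈ T, x a := by
  rw [← coeff_prod_one_add, prod_one_add, MvPolynomial.coeff_sum, MvPolynomial.coeff_sum]
  refine sum_subset (fun T _ => mem_powerset.2 (subset_univ _)) fun T _ hT => ?_
  have hhom : (∏ p ∈ T, (MvPolynomial.C (x p.1) * MvPolynomial.X p.2 :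
      MvPolynomial B S)).IsHomogeneous (∑ _p ∈ T, 1) :=
    MvPolynomial.IsHomogeneous.prod _ _ _ fun p _ => by
      simpa using (MvPolynomial.isHomogeneous_C B (x p.1)).mul (MvPolynomial.isHomogeneous_X S p.2)
  refine hhom.coeff_eq_zero fun h => hT (mem_powersetCard.2 ⟨subset_univ _, ?_⟩)
  rw [Finsupp.degree_eq_sum] at h
  simp only [Finsupp.equivFunOnFinite_symm_apply_apply, hκ] at h
  simpa using h.symm

/-- Expand $e_n$ of the variables $x_ay_b$ in power sums and compare coefficients of $y^\kappa$. On
the class of $\sigma$ the signs multiply to $\mathrm{sgn}\,\sigma$, and the $y$-part counts the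
colourings of content $\kappa$ fixed by $\sigma$: together, the character. -/
theorem prod_esymm_eq_sum {n : ℕ} (κ : B → ℕ) (hκ : ∑ b, κ b = n) (N : ℕ) :
    ∏ b, MvPolynomial.esymm (Fin N) ℂ (κ b) =
      ∑ lam : n.Partition, ((zee lam : ℂ)⁻¹ *
        (colourFDRep n κ).character (exists_cycleShape lam).choose) •
          (lam.parts.map (MvPolynomial.psum (Fin N) ℂ)).prod := by
  classical
  have h1 := coeff_sum_powersetCard (S := MvPolynomial (Fin N) ℂ) MvPolynomial.X κ hκ
  rw [sum_powersetCard_eq_partSum, partSum, MvPolynomial.coeff_sum] at h1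
  refine h1.symm.trans (sum_congr rfl fun lam _ => ?_)
  rw [character_colourFDRep]
  have hσ := (exists_cycleShape lam).choose_spec
  generalize (exists_cycleShape lam).choose = σ at hσ
  subst hσ
  have h2 : ((cycleShape σ).parts.map fun l => -(-1) ^ l * ∑ p : Fin N × B,
      (MvPolynomial.C (MvPolynomial.X p.1) * MvPolynomial.X p.2 :
        MvPolynomial B (MvPolynomial (Fin N) ℂ)) ^ l).prod =
      MvPolynomial.C (MvPolynomial.C ((Equiv.Perm.sign σ : ℤ) : ℂ) *
        ((cycleShape σ).parts.map (MvPolynomial.psum (Fin N) ℂ)).prod) *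
      ∑ c : Fin n → B with c ∘ σ = c, ∏ i, MvPolynomial.X (c i) := by
    rw [sum_invariant_colourings, sign_eq_prod_parts]
    exact prod_map_signed_sum N _
  rw [h2, one_mul]
  have h3 : MvPolynomial.coeff (Finsupp.equivFunOnFinite.symm κ)
      (∑ c : Fin n → B with c ∘ σ = c, ∏ i, (MvPolynomial.X (c i) :
        MvPolynomial B (MvPolynomial (Fin N) ℂ))) = (#{c : Colouring n κ | c.comp σ = c} : ℕ) := by
    have hX : ∀ c : Fin n → B, ∏ i, (MvPolynomial.X (c i) :
        MvPolynomial B (MvPolynomial (Fin N) ℂ)) =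
        MvPolynomial.monomial (∑ i, Finsupp.single (c i) 1) 1 := by
      intro c
      rw [MvPolynomial.monomial_sum_one]
      rfl
    rw [MvPolynomial.coeff_sum, sum_congr rfl fun c _ => by
      rw [hX, MvPolynomial.coeff_monomial, ← ite_congr (propext (sum_single_eq_iff c κ).symm)
        (fun _ => rfl) (fun _ => rfl)], sum_boole, filter_filter]
    congr 1
    symm
    refine card_bij (fun c _ => c.1) ?_ ?_ ?_
    · intro c hc
      exact mem_filter.2 ⟨mem_univ _, congrArg Subtype.val (mem_filter.1 hc).2, c.2⟩
    · exact fun c _ c' _ h => Subtype.ext h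
    · intro c hc
      obtain ⟨-, h1, h2⟩ := mem_filter.1 hc
      exact ⟨⟨c, h2⟩, mem_filter.2 ⟨mem_univ _, Subtype.ext h1⟩, rfl⟩
  rw [MvPolynomial.coeff_smul, MvPolynomial.coeff_C_mul, h3]
  rw [Algebra.smul_def, Algebra.smul_def]
  simp only [map_mul, IsScalarTower.algebraMap_apply ℚ ℂ (MvPolynomial (Fin N) ℂ)]
  simp
  ring

end Cauchy

/-! ### Integral symmetric polynomials are Frobenius characteristics -/

section Virtual

variable {n : ℕ}

/-- The product of power sums attached to a partition, in `N` variables. -/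
noncomputable def psumPart (N : ℕ) (lam : n.Partition) : MvPolynomial (Fin N) ℂ :=
  (lam.parts.map (MvPolynomial.psum (Fin N) ℂ)).prod

/-- The Frobenius characteristic of a virtual representation, in `N` variables. -/
noncomputable def frobeniusPoly (N : ℕ) (V : VirtualRep n) : MvPolynomial (Fin N) ℂ :=
  ∑ lam : n.Partition, ((zee lam : ℂ)⁻¹ * V.characterAt lam) • psumPart N lam

theorem exists_character_add (V W : FDRep ℂ (Equiv.Perm (Fin n))) :
    ∃ U : FDRep ℂ (Equiv.Perm (Fin n)), ∀ σ, U.character σ = V.character σ + W.character σ :=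
  ⟨FDRep.of (Representation.prod V.ρ W.ρ), fun σ =>
    LinearMap.trace_prodMap' (V.ρ σ) (W.ρ σ)⟩

/-- The Frobenius characteristics of virtual representations, in `N` variables. -/
noncomputable def frobeniusSubgroup (n N : ℕ) : AddSubgroup (MvPolynomial (Fin N) ℂ) where
  carrier := Set.range (frobeniusPoly (n := n) N)
  zero_mem' := ⟨⟨FDRep.of (Representation.trivial ℂ _ ℂ), FDRep.of (Representation.trivial ℂ _ ℂ)⟩,
    by simp [frobeniusPoly, VirtualRep.characterAt, VirtualRep.character]⟩
  add_mem' := by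
    rintro _ _ ⟨V, rfl⟩ ⟨W, rfl⟩
    obtain ⟨P, hP⟩ := exists_character_add V.pos W.pos
    obtain ⟨M, hM⟩ := exists_character_add V.neg W.neg
    refine ⟨⟨P, M⟩, ?_⟩
    simp only [frobeniusPoly, VirtualRep.characterAt, VirtualRep.character, hP, hM,
      ← sum_add_distrib, ← add_smul]
    refine sum_congr rfl fun lam _ => ?_
    congr 1
    ring
  neg_mem' := by
    rintro _ ⟨V, rfl⟩
    refine ⟨⟨V.neg, V.pos⟩, ?_⟩
    simp only [frobeniusPoly, VirtualRep.characterAt, VirtualRep.character, ← sum_neg_distrib,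
      ← neg_smul]
    refine sum_congr rfl fun lam _ => ?_
    congr 1
    ring

theorem prod_esymm_mem_frobeniusSubgroup {B : Type} [Fintype B] (κ : B → ℕ) (hκ : ∑ b, κ b = n)
    (N : ℕ) : ∏ b, MvPolynomial.esymm (Fin N) ℂ (κ b) ∈ frobeniusSubgroup n N := by
  classical
  -- A trivial summand is added on both sides of the formal difference and cancels.
  obtain ⟨P, hP⟩ := exists_character_add (colourFDRep n κ)
    (FDRep.of (Representation.trivial ℂ (Equiv.Perm (Fin n)) ℂ))
  refine ⟨⟨P, FDRep.of (Representation.trivial ℂ _ ℂ)⟩, ?_⟩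
  rw [prod_esymm_eq_sum κ hκ]
  simp [frobeniusPoly, VirtualRep.characterAt, VirtualRep.character, hP, psumPart]

theorem prod_esymm_pow_eq {R : Type*} [CommRing R] (N : ℕ) (t : Fin n → ℕ) :
    ∏ i : Fin n, MvPolynomial.esymm (Fin N) R (i + 1) ^ t i =
      ∏ b : (i : Fin n) × Fin (t i), MvPolynomial.esymm (Fin N) R (b.1 + 1) := by
  rw [Fintype.prod_sigma]
  simp

theorem isHomogeneous_esymm (R : Type*) [CommRing R] (N k : ℕ) :
    (MvPolynomial.esymm (Fin N) R k).IsHomogeneous k := by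
  refine MvPolynomial.IsHomogeneous.sum _ _ _ fun T hT => ?_
  have := MvPolynomial.IsHomogeneous.prod T (fun i => (MvPolynomial.X i : MvPolynomial (Fin N) R))
    (fun _ => 1) fun i _ => MvPolynomial.isHomogeneous_X R i
  simpa [(mem_powersetCard.1 hT).2] using this

/-- The fundamental theorem over $\mathbb Z$ writes $f$ as an integral polynomial in
$e_1,\dots,e_n$. Homogeneity retains only the products of degree $n$. -/
theorem map_mem_frobeniusSubgroup {f : MvPolynomial (Fin n) ℤ} (hs : f.IsSymmetric)
    (hh : f.IsHomogeneous n) :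
    MvPolynomial.map (Int.castRingHom ℂ) f ∈ frobeniusSubgroup n n := by
  obtain ⟨P, hP⟩ := MvPolynomial.esymmAlgHom_surjective (σ := Fin n) ℤ (n := n) (by simp) ⟨f, hs⟩
  have hf := MvPolynomial.esymmAlgHom_apply (σ := Fin n) (R := ℤ) (n := n) P
  rw [hP, MvPolynomial.aeval_def, MvPolynomial.eval₂_eq'] at hf
  simp only at hf
  have hhom : ∀ t : Fin n →₀ ℕ, (algebraMap ℤ (MvPolynomial (Fin n) ℤ) (P.coeff t) *
      ∏ i : Fin n, MvPolynomial.esymm (Fin n) ℤ (i + 1) ^ t i).IsHomogeneous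
        (0 + ∑ i : Fin n, (i + 1) * t i) := fun t =>
    (MvPolynomial.isHomogeneous_C _ _).mul
      (MvPolynomial.IsHomogeneous.prod _ _ _ fun i _ => (isHomogeneous_esymm ℤ n _).pow _)
  have hf' : f = ∑ t ∈ P.support, if n = 0 + ∑ i : Fin n, (i + 1) * t i then
      (algebraMap ℤ (MvPolynomial (Fin n) ℤ) (P.coeff t) *
        ∏ i : Fin n, MvPolynomial.esymm (Fin n) ℤ (i + 1) ^ t i) else 0 := by
    have h1 : MvPolynomial.homogeneousComponent n f = f := by
      rw [MvPolynomial.homogeneousComponent_of_mem hh, if_pos rfl]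
    conv_lhs => rw [← h1, hf, map_sum]
    exact sum_congr rfl fun t _ => MvPolynomial.homogeneousComponent_of_mem (hhom t)
  rw [hf', map_sum]
  refine AddSubgroup.sum_mem _ fun t _ => ?_
  split_ifs with ht
  · rw [map_mul, map_prod]
    simp only [map_pow, MvPolynomial.map_esymm]
    rw [prod_esymm_pow_eq]
    have := (frobeniusSubgroup n n).zsmul_mem (prod_esymm_mem_frobeniusSubgroup
      (B := (i : Fin n) × Fin (t i)) (fun b => b.1 + 1) (by
        rw [Fintype.sum_sigma]
        simp only [sum_const, card_univ, Fintype.card_fin, smul_eq_mul]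
        rw [zero_add] at ht
        conv_rhs => rw [ht]
        exact sum_congr rfl fun i _ => mul_comm _ _) n) (P.coeff t)
    rw [zsmul_eq_mul] at this
    convert this using 2
    simp
  · rw [map_zero]
    exact zero_mem _

/-- The multiplicities of the parts of a partition. -/
noncomputable def partCounts (lam : n.Partition) : Fin n →₀ ℕ :=
  Finsupp.equivFunOnFinite.symm fun i => lam.parts.count ((i : ℕ) + 1)

theorem partCounts_injective : Function.Injective (partCounts (n := n)) := by
  intro lam mu h
  refine Nat.Partition.ext (Multiset.ext.2 fun l => ?_)
  by_cases hl : 1 ≤ l ∧ l ≤ n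
  · have := DFunLike.congr_fun h ⟨l - 1, by omega⟩
    simp only [partCounts, Finsupp.equivFunOnFinite_symm_apply_apply] at this
    rwa [Nat.sub_add_cancel hl.1] at this
  · have : ∀ nu : n.Partition, nu.parts.count l = 0 := fun nu =>
      Multiset.count_eq_zero_of_notMem fun hm => hl ⟨nu.parts_pos hm, nu.le_of_mem_parts hm⟩
    rw [this, this]

theorem sum_mul_partCounts (lam : n.Partition) :
    ∑ b : (i : Fin n) × Fin (partCounts lam i), (b.1.1 + 1) = n := by
  rw [Fintype.sum_sigma]
  simp only [sum_const, card_univ, Fintype.card_fin, smul_eq_mul]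
  simp only [partCounts, Finsupp.equivFunOnFinite_symm_apply_apply]
  conv_rhs => rw [← sum_mul_count lam]
  rw [Fin.sum_univ_eq_sum_range (fun i => lam.parts.count (i + 1) * (i + 1)) n, range_eq_Ico,
    sum_Ico_add' (fun i => lam.parts.count i * i) 0 n 1]
  simp only [zero_add, mul_comm]
  rfl

/-- Dimension count: the products of elementary symmetric polynomials indexed by partitions are
independent, and by the Frobenius formula they lie in the span of equally many $p_\lambda$. -/
theorem linearIndependent_psumPart :
    LinearIndependent ℂ (psumPart (n := n) n) := by
  have he : LinearIndependent ℂ fun lam : n.Partition =>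
      ∏ b : (i : Fin n) × Fin (partCounts lam i), MvPolynomial.esymm (Fin n) ℂ (b.1.1 + 1) := by
    set φ := (MvPolynomial.symmetricSubalgebra (Fin n) ℂ).val.comp
      (MvPolynomial.esymmAlgHom (Fin n) ℂ n)
    have hφ : LinearMap.ker φ.toLinearMap = ⊥ := LinearMap.ker_eq_bot.2
      (Subtype.val_injective.comp (MvPolynomial.esymmAlgHom_injective ℂ (by simp)))
    have hfun : (fun lam : n.Partition => ∏ b : (i : Fin n) × Fin (partCounts lam i),
        MvPolynomial.esymm (Fin n) ℂ (b.1.1 + 1)) =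
        φ.toLinearMap ∘ MvPolynomial.basisMonomials (Fin n) ℂ ∘ partCounts := by
      funext lam
      rw [← prod_esymm_pow_eq]
      simp only [φ, Function.comp_apply, MvPolynomial.coe_basisMonomials, AlgHom.toLinearMap_apply,
        AlgHom.comp_apply, Subalgebra.coe_val]
      rw [MvPolynomial.esymmAlgHom_apply, MvPolynomial.aeval_monomial, map_one, one_mul,
        Finsupp.prod_fintype _ _ (fun _ => pow_zero _)]
    rw [hfun]
    exact ((MvPolynomial.basisMonomials (Fin n) ℂ).linearIndependent.comp _
      partCounts_injective).map' _ hφ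
  have : Module.Finite ℂ (Submodule.span ℂ (Set.range (psumPart (n := n) n))) :=
    FiniteDimensional.span_of_finite ℂ (Set.finite_range _)
  rw [linearIndependent_iff_card_le_finrank_span, ← finrank_span_eq_card he, Set.finrank]
  refine Submodule.finrank_mono (Submodule.span_le.2 ?_)
  rintro _ ⟨lam, rfl⟩
  obtain ⟨V, hV⟩ := prod_esymm_mem_frobeniusSubgroup _ (sum_mul_partCounts lam) n
  rw [SetLike.mem_coe]
  beta_reduce
  rw [← hV]
  exact Submodule.sum_mem _ fun mu _ =>
    Submodule.smul_mem _ _ (Submodule.subset_span (Set.mem_range_self mu))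

end Virtual

/-! ### Truncation to finitely many variables -/

section Truncation

/-- Setting all but the first `N` variables equal to `0`. -/
noncomputable def truncVars (N : ℕ) : MvPowerSeries ℕ ℂ →ₐ[ℂ] MvPowerSeries (Fin N) ℂ :=
  MvPowerSeries.killCompl Fin.valEmbedding

theorem coeff_truncVars (N : ℕ) (f : MvPowerSeries ℕ ℂ) (m : Fin N →₀ ℕ) :
    MvPowerSeries.coeff m (truncVars N f) =
      MvPowerSeries.coeff (Finsupp.embDomain Fin.valEmbedding m) f :=
  MvPowerSeries.coeff_killCompl f m

/-- Each monomial involves finitely many variables, so its coefficient survives truncation for large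
$N$. -/
theorem truncVars_ext {f g : MvPowerSeries ℕ ℂ} (h : ∀ N, truncVars N f = truncVars N g) :
    f = g := by
  ext m
  obtain ⟨N, hN⟩ : ∃ N, ∀ i ∈ m.support, i < N :=
    ⟨m.support.sup id + 1, fun i hi => Nat.lt_succ_of_le (le_sup (f := id) hi)⟩
  have hm : Finsupp.embDomain Fin.valEmbedding
      (Finsupp.equivFunOnFinite.symm fun i : Fin N => m i) = m := by
    ext i
    by_cases hi : i < N
    · have := Finsupp.embDomain_apply_self Fin.valEmbedding
        (Finsupp.equivFunOnFinite.symm fun i : Fin N => m i) ⟨i, hi⟩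
      simpa using this
    · rw [Finsupp.embDomain_of_notMem_range _ _ _ (by simpa using hi)]
      by_contra h
      exact hi (hN i (Finsupp.mem_support_iff.2 (Ne.symm h)))
  rw [← hm, ← coeff_truncVars, ← coeff_truncVars, h]

/-- Positivity of $l$ is essential: for $l=0$ the series `powerSum` is $1$, while
`MvPolynomial.psum` is $N$. -/
theorem truncVars_powerSum (N : ℕ) {l : ℕ} (hl : 0 < l) :
    truncVars N (powerSum ℂ l) = (MvPolynomial.psum (Fin N) ℂ l : MvPolynomial (Fin N) ℂ) := by
  classical
  ext m
  rw [coeff_truncVars, MvPolynomial.coeff_coe, MvPolynomial.psum, MvPolynomial.coeff_sum]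
  simp only [MvPolynomial.coeff_X_pow]
  change (if _ then (1 : ℂ) else 0) = _
  split_ifs with h
  · obtain ⟨k, hk⟩ := h
    have hmem : ∃ a : Fin N, (a : ℕ) = k := by
      by_contra hne
      have h1 := DFunLike.congr_fun hk k
      rw [Finsupp.embDomain_of_notMem_range _ _ _ hne,
        Finsupp.single_eq_same] at h1
      omega
    obtain ⟨a, rfl⟩ := hmem
    have hm : m = Finsupp.single a l := by
      apply Finsupp.embDomain_injective Fin.valEmbedding
      rw [hk, Finsupp.embDomain_single]
      rfl
    rw [hm, sum_eq_single a]
    · simp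
    · intro b _ hb
      rw [if_neg]
      intro h
      exact hb ((Finsupp.single_left_inj hl.ne').1 h)
    · simp
  · symm
    refine sum_eq_zero fun a _ => if_neg fun ha => h ⟨a, ?_⟩
    rw [← ha, Finsupp.embDomain_single]
    rfl

theorem truncVars_powerSumPart (N : ℕ) {n : ℕ} (lam : n.Partition) :
    truncVars N (powerSumPart ℂ lam) = (psumPart N lam : MvPolynomial (Fin N) ℂ) := by
  rw [powerSumPart, psumPart, map_multiset_prod, Multiset.map_map,
    ← MvPolynomial.coeToMvPowerSeries.ringHom_apply, map_multiset_prod, Multiset.map_map]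
  congr 1
  exact Multiset.map_congr rfl fun l hl => truncVars_powerSum N (lam.parts_pos hl)

open Classical in
theorem truncVars_fundamental (N n : ℕ) (S : Set ℕ) :
    truncVars N (fundamental ℂ n S) =
      ((∑ s : Fin n → Fin N with CompatSeq S s, ∏ i, MvPolynomial.X (s i) :
        MvPolynomial (Fin N) ℂ) : MvPowerSeries (Fin N) ℂ) := by
  ext m
  have hX : ∀ s : Fin n → Fin N, ∏ i, (MvPolynomial.X (s i) : MvPolynomial (Fin N) ℂ) =
      MvPolynomial.monomial (∑ i, Finsupp.single (s i) 1) 1 := fun s => by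
    rw [MvPolynomial.monomial_sum_one]
    rfl
  have hemb : ∀ s : Fin n → Fin N, Finsupp.embDomain Fin.valEmbedding
      (∑ i, Finsupp.single (s i) 1) = ∑ i, Finsupp.single (s i : ℕ) 1 := by
    intro s
    rw [← Finsupp.embDomain.addMonoidHom_apply, map_sum]
    exact sum_congr rfl fun i _ => Finsupp.embDomain_single _ _ _
  rw [coeff_truncVars, MvPolynomial.coeff_coe, MvPolynomial.coeff_sum]
  simp only [hX, MvPolynomial.coeff_monomial, sum_boole]
  change ((fundamentalSeqs n S _).ncard : ℂ) = _
  rw [filter_filter, ← Set.ncard_coe_finset]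
  congr 1
  symm
  refine Set.ncard_congr (fun s _ i => (s i : ℕ)) ?_ ?_ ?_
  · intro s hs
    obtain ⟨-, ⟨h1, h2⟩, h3⟩ := mem_filter.1 (mem_coe.1 hs)
    exact ⟨fun i j hij => h1 hij, h2, by rw [← h3, hemb]⟩
  · intro s s' _ _ h
    exact funext fun i => Fin.ext (congrFun h i)
  · rintro u ⟨h1, h2, h3⟩
    have hlt : ∀ i, u i < N := by
      intro i
      by_contra hi
      have h4 := DFunLike.congr_fun h3 (u i)
      rw [Finsupp.embDomain_of_notMem_range _ _ _ (by simpa using hi), Finsupp.finsetSum_apply,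
        sum_eq_zero_iff] at h4
      simpa using h4 i (mem_univ i)
    refine ⟨fun i => ⟨u i, hlt i⟩, mem_coe.2 (mem_filter.2 ⟨mem_univ _, ⟨fun i j hij => h1 hij, h2⟩,
      Finsupp.embDomain_injective Fin.valEmbedding ?_⟩), rfl⟩
    rw [hemb, ← h3]

theorem cycleShape_eq_indiscrete_iff {n : ℕ} (hn : 2 ≤ n) (σ : Equiv.Perm (Fin n)) :
    cycleShape σ = Nat.Partition.indiscrete n ↔ σ.IsCycleOn Set.univ := by
  have hparts : (cycleShape σ).parts =
      σ.cycleType + Multiset.replicate (Fintype.card (Fin n) - σ.support.card) 1 := rfl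
  rw [Nat.Partition.ext_iff, Nat.Partition.indiscrete_parts (by omega : n ≠ 0), hparts]
  constructor
  · intro h
    have h0 : Fintype.card (Fin n) - σ.support.card = 0 := by
      by_contra hne
      have : 1 ∈ ({n} : Multiset ℕ) := by
        rw [← h]
        exact Multiset.mem_add.2 (Or.inr (Multiset.mem_replicate.2 ⟨hne, rfl⟩))
      rw [Multiset.mem_singleton] at this
      omega
    rw [h0, Multiset.replicate_zero, add_zero] at h
    have hc : σ.IsCycle := Equiv.Perm.card_cycleType_eq_one.1 (by simp [h])
    have hs : σ.support = univ := by
      rw [← card_eq_iff_eq_univ]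
      have := card_le_univ σ.support
      omega
    have hset : {x | σ x ≠ x} = Set.univ := by
      ext x
      simpa [hs] using (Equiv.Perm.mem_support (f := σ) (x := x)).symm
    simpa [hset] using hc.isCycleOn
  · intro h
    have hnt : (Set.univ : Set (Fin n)).Nontrivial :=
      ⟨⟨0, by omega⟩, Set.mem_univ _, ⟨1, by omega⟩, Set.mem_univ _, by simp⟩
    have hc : σ.IsCycle :=
      Equiv.Perm.isCycle_iff_exists_isCycleOn.2 ⟨Set.univ, hnt, h, fun _ _ => Set.mem_univ _⟩
    have hs : σ.support = univ := by
      ext x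
      simpa using h.apply_ne hnt (Set.mem_univ x)
    rw [hc.cycleType, hs]
    simp

theorem truncVars_Q {n : ℕ} (hn : 2 ≤ n) (j N : ℕ) :
    truncVars N (Q ℂ (Nat.Partition.indiscrete n) j) =
      (cycleQ ℂ N n j : MvPolynomial (Fin N) ℂ) := by
  classical
  rw [Q, cycleQ, map_sum, ← MvPolynomial.coeToMvPowerSeries.ringHom_apply, map_sum]
  refine sum_congr ?_ fun σ _ => truncVars_fundamental N n _
  ext σ
  simp [cycleShape_eq_indiscrete_iff hn]

theorem truncVars_sum_powerSumPart {n : ℕ} (N : ℕ) (c : n.Partition → ℂ) :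
    truncVars N (∑ lam, c lam • powerSumPart ℂ lam) =
      ((∑ lam, c lam • psumPart N lam : MvPolynomial (Fin N) ℂ) : MvPowerSeries (Fin N) ℂ) := by
  rw [map_sum, ← MvPolynomial.coeToMvPowerSeries.ringHom_apply, map_sum]
  refine sum_congr rfl fun lam _ => ?_
  rw [map_smul, truncVars_powerSumPart, MvPolynomial.coeToMvPowerSeries.ringHom_apply,
    MvPolynomial.coe_smul]

end Truncation

/-! ### The main theorem -/

theorem map_cycleQ (N n j : ℕ) :
    MvPolynomial.map (Int.castRingHom ℂ) (cycleQ ℤ N n j) = cycleQ ℂ N n j := by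
  simp [cycleQ, map_sum, map_prod]

theorem isHomogeneous_cycleQ (R : Type*) [CommRing R] (N n j : ℕ) :
    (cycleQ R N n j).IsHomogeneous n := by
  refine MvPolynomial.IsHomogeneous.sum _ _ _ fun σ _ =>
    MvPolynomial.IsHomogeneous.sum _ _ _ fun s _ => ?_
  have := MvPolynomial.IsHomogeneous.prod univ
    (fun i => (MvPolynomial.X (s i) : MvPolynomial (Fin N) R)) (fun _ => 1)
    fun i _ => MvPolynomial.isHomogeneous_X R (s i)
  simpa using this

theorem isSymmetric_psumPart (N : ℕ) {n : ℕ} (lam : n.Partition) :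
    (psumPart N lam).IsSymmetric := by
  rw [psumPart]
  induction lam.parts using Multiset.induction_on with
  | empty => simp
  | cons l M ih =>
    rw [Multiset.map_cons, Multiset.prod_cons]
    exact (MvPolynomial.psum_isSymmetric (Fin N) ℂ l).mul ih

/-- Symmetry is read off the complex power sum expansion and descends to the integral polynomial
because $\mathbb Z\to\mathbb C$ is injective. -/
theorem exists_virtualRep {n : ℕ} {j : ℕ} {a : n.Partition → ℂ}
    (ha : cycleQ ℂ n n j = ∑ lam, a lam • psumPart n lam) :
    ∃ V : VirtualRep n, ∀ lam, (zee lam : ℂ)⁻¹ * V.characterAt lam = a lam := by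
  have hsC : (cycleQ ℂ n n j).IsSymmetric := by
    rw [ha]
    intro e
    rw [map_sum]
    refine sum_congr rfl fun lam _ => ?_
    rw [map_smul, isSymmetric_psumPart n lam e]
  have hsZ : (cycleQ ℤ n n j).IsSymmetric := by
    intro e
    apply MvPolynomial.map_injective (Int.castRingHom ℂ) Int.cast_injective
    rw [MvPolynomial.map_rename, map_cycleQ]
    exact hsC e
  obtain ⟨V, hV⟩ := map_mem_frobeniusSubgroup hsZ (isHomogeneous_cycleQ ℤ n n j)
  rw [map_cycleQ, ha] at hV
  exact ⟨V, fun lam => congrFun (linearIndependent_psumPart.fintypeLinearCombination_injective hV) lam⟩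

theorem G_eq_cyclePoly {n : ℕ} {lam : n.Partition} (h : 1 ∈ lam.parts) : G lam = cyclePoly lam := by
  have hg : lam.parts.gcd = 1 := Nat.dvd_one.1 (Multiset.gcd_dvd h)
  rw [G, eraseNonCoprime, hg]
  simpa using (cyclePoly lam).as_sum_support.symm

end EulerianQSym

open EulerianQSym in
/-- For `n ≥ 2`, `Q_{(n),j}` is the Frobenius characteristic of a virtual representation `V_{(n),j}`
of `S_n`; its character at each `σ` whose cycle type `λ` has a part equal to `1` is the coefficient
of `t ^ j` in `t A_{k-1}(t) ∏ [λ_i]_t`, which is also the coefficient of `t ^ j` in `G_λ(t)`; and in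
the power sum expansion of `Q_{(n),j}` the coefficient of `p_λ` is `z_λ⁻¹` times that number. -/
theorem mainTheorem11 (n : ℕ) (hn : 2 ≤ n) (j : ℕ) :
    (∃ V : VirtualRep n, V.frobenius = Q ℂ (Nat.Partition.indiscrete n) j) ∧
    (∀ V : VirtualRep n, V.frobenius = Q ℂ (Nat.Partition.indiscrete n) j →
      ∀ (lam : n.Partition) (σ : Equiv.Perm (Fin n)), cycleShape σ = lam → 1 ∈ lam.parts →
        V.character σ = ((cyclePoly lam).coeff j : ℂ) ∧
        V.character σ = ((G lam).coeff j : ℂ)) ∧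
    (∀ c : n.Partition → ℂ,
      Q ℂ (Nat.Partition.indiscrete n) j = ∑ mu : n.Partition, c mu • powerSumPart ℂ mu →
      ∀ lam : n.Partition, 1 ∈ lam.parts →
        c lam = (zee lam : ℂ)⁻¹ * ((G lam).coeff j : ℂ)) := by
  obtain ⟨a, ha1, ha⟩ := exists_cycleQ_eq hn j
  -- Truncation to $n$ variables already keeps the $p_\lambda$ with $\lambda\vdash n$ independent,
  -- so the expansion is unique and every admissible $V$ has the same character values.
  have huniq : ∀ c : n.Partition → ℂ,
      Q ℂ (Nat.Partition.indiscrete n) j = ∑ mu : n.Partition, c mu • powerSumPart ℂ mu →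
      c = a := by
    intro c hc
    have h1 := congrArg (truncVars n) hc
    rw [truncVars_Q hn, truncVars_sum_powerSumPart] at h1
    exact linearIndependent_psumPart.fintypeLinearCombination_injective
      ((MvPolynomial.coe_injective _ _ h1).symm.trans (ha n))
  refine ⟨?_, ?_, ?_⟩
  · obtain ⟨V, hV⟩ := exists_virtualRep (ha n)
    refine ⟨V, truncVars_ext fun N => ?_⟩
    rw [truncVars_Q hn, VirtualRep.frobenius, truncVars_sum_powerSumPart, ha N]
    simp only [hV]
    rfl
  · rintro V hV lam σ rfl hlam
    have h1 := congrFun (huniq _ hV.symm) (cycleShape σ)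
    have hz : (zee (cycleShape σ) : ℂ)⁻¹ ≠ 0 :=
      inv_ne_zero (by exact_mod_cast (zee_pos _).ne')
    rw [ha1 _ hlam, V.characterAt_cycleShape] at h1
    have h2 := mul_left_cancel₀ hz h1
    exact ⟨h2, by rw [G_eq_cyclePoly hlam, h2]⟩
  · intro c hc lam hlam
    rw [huniq c hc, ha1 lam hlam, G_eq_cyclePoly hlam]
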